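/- Let $R$ and $S$ be associative rings with unit; modules are left modules unless said otherwise, and right $S$-modules are $S^{op}$-modules. Let ${}_R\omega_S$ be a semidualizing $(R,S)$-bimodule, i.e. an $(R,S)$-bimodule such that ${}_R\omega$ and $\omega_S$ admit projective resolutions by finitely generated projective modules, the homothety maps $R\to\mathrm{Hom}_{S^{op}}(\omega,\omega)$ and $S\to\mathrm{Hom}_R(\omega,\omega)$ are isomorphisms, and $\mathrm{Ext}^i_R(\omega,\omega)=0=\mathrm{Ext}^i_{S^{op}}(\omega,\omega)$ for all $i\ge 1$. Write $M_*=\mathrm{Hom}_R(\omega,M)$, an $S$-module via $(sf)(x)=f(xs)$, and define the following classes of $R$-modules: - ${}_R\omega^{\perp}$ is the class of $M$ with $\mathrm{Ext}_R^i(\omega,M)=0$ for all $i\ge 1$; - the Bass class $\mathcal{B}_\omega(R)$ is the class of $M\in{}_R\omega^{\perp}$ such that $\mathrm{Tor}_i^S(\omega,M_*)=0$ for all $i\ge1$ and the evaluation map $\theta_M:\omega\otimes_S M_*\to M$, $x\otimes f\mapsto f(x)$, is an isomorphism; - $\mathrm{c}\mathcal{T}(R)$ is the class of $\infty$-$\omega$-cotorsionfree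 modules, i.e. of $M$ with $\mathrm{Tor}_i^S(\omega,\mathrm{cTr}_\omega M)=0$ for all $i\ge1$, where $\mathrm{cTr}_\omega M=\mathrm{Coker}\big((f^0)_*:I^0(M)_*\to I^1(M)_*\big)$ and $0\to M\to I^0(M)\xrightarrow{f^0}I^1(M)\to\cdots$ is a minimal injective resolution of $M$. Then: 1. If $\mathrm{pd}_R\,\omega<\infty$, then $\mathrm{c}\mathcal{T}(R)\subseteq{}_R\omega^{\perp}$ and $\mathcal{B}_\omega(R)=\mathrm{c}\mathcal{T}(R)$. 2. If $\mathrm{pd}_{S^{op}}\,\omega<\infty$, then ${}_R\omega^{\perp}\subseteq\mathrm{c}\mathcal{T}(R)$ and $\mathcal{B}_\omega(R)={}_R\omega^{\perp}$. -/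

import Mathlib

open CategoryTheory
open scoped TensorProduct

universe u

namespace Semidualizing

/-! ## Injective envelopes and the start of the minimal injective resolution -/

section Envelope

variable {R : Type u} [Ring R]

/-- A submodule `N` of `E` is essential (large): it meets every nonzero submodule of `E`. -/
def IsEssential {E : Type u} [AddCommGroup E] [Module R E] (N : Submodule R E) : Prop :=
  ∀ L : Submodule R E, N ⊓ L = ⊥ → L = ⊥

variable (R) in
/-- An injective envelope of a left `R`-module `M`: an embedding `ι` of `M` as an essential
submodule of an injective module `E`. -/
structure InjectiveEnvelope (M : Type u) [AddCommGroup M] [Module R M] where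
  E : Type u
  [addCommGroup : AddCommGroup E]
  [module : Module R E]
  ι : M →ₗ[R] E
  injective : Module.Injective R E
  ι_injective : Function.Injective ι
  essential : IsEssential (LinearMap.range ι)

attribute [instance] InjectiveEnvelope.addCommGroup InjectiveEnvelope.module

theorem exists_envelope_submodule {J : Type u} [AddCommGroup J] [Module R J]
    [hJ : Module.Injective R J] (N : Submodule R J) :
    ∃ E : Submodule R J, Module.Injective R E ∧ N ≤ E ∧
      ∀ L : Submodule R J, L ≤ E → N ⊓ L = ⊥ → L = ⊥ := by
  -- `E` is a maximal essential extension of `N` inside `J`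
  obtain ⟨E, hNE, hEmax⟩ := zorn_le_nonempty₀
    {E : Submodule R J | N ≤ E ∧ ∀ L : Submodule R J, L ≤ E → N ⊓ L = ⊥ → L = ⊥} (by
      intro c hc hchain y hy
      refine ⟨sSup c, ⟨(hc hy).1.trans (le_sSup hy), ?_⟩, fun z hz => le_sSup hz⟩
      intro L hL hNL
      rw [Submodule.eq_bot_iff]
      intro x hx
      obtain ⟨z, hz, hxz⟩ :=
        (Submodule.mem_sSup_of_directed ⟨y, hy⟩ hchain.directedOn).1 (hL hx)
      have h1 : L ⊓ z = ⊥ := (hc hz).2 _ inf_le_right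
        (le_bot_iff.1 ((inf_le_inf_left N inf_le_left).trans hNL.le))
      exact (Submodule.mem_bot R).1 (h1 ▸ (Submodule.mem_inf.2 ⟨hx, hxz⟩)))
    N ⟨le_rfl, fun L hL h => by rwa [inf_eq_right.2 hL] at h⟩
  have hEess := hEmax.prop.2
  -- `C` is a maximal submodule with `E ⊓ C = ⊥`
  obtain ⟨C, -, hCmax⟩ := zorn_le_nonempty₀ {C : Submodule R J | E ⊓ C = ⊥} (by
      intro c hc hchain y hy
      refine ⟨sSup c, ?_, fun z hz => le_sSup hz⟩
      change E ⊓ sSup c = ⊥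
      rw [Submodule.eq_bot_iff]
      rintro x hx
      obtain ⟨z, hz, hxz⟩ :=
        (Submodule.mem_sSup_of_directed ⟨y, hy⟩ hchain.directedOn).1 hx.2
      have h1 : E ⊓ z = ⊥ := hc hz
      exact (Submodule.mem_bot R).1 (h1 ▸ (Submodule.mem_inf.2 ⟨hx.1, hxz⟩)))
    ⊥ (by simp)
  have hEC : E ⊓ C = ⊥ := hCmax.prop
  have hj : Function.Injective (C.mkQ ∘ₗ E.subtype) := by
    rw [← LinearMap.ker_eq_bot, LinearMap.ker_eq_bot']
    intro x hx
    have hxC : (x : J) ∈ C := (Submodule.Quotient.mk_eq_zero C).1 hx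
    exact Subtype.ext ((Submodule.mem_bot R).1 (hEC ▸ Submodule.mem_inf.2 ⟨x.2, hxC⟩))
  obtain ⟨ψ, hψ⟩ := hJ.out _ hj E.subtype
  -- the extension `ψ : J ⧸ C → J` of the inclusion of `E` is injective
  have key : ∀ K : Submodule R (J ⧸ C), (∀ x ∈ E, C.mkQ x ∈ K → x = 0) → K = ⊥ := by
    intro K hK
    have h1 : E ⊓ K.comap C.mkQ = ⊥ := by
      rw [Submodule.eq_bot_iff]
      rintro x hx
      exact hK x hx.1 hx.2
    have h2 : C ≤ K.comap C.mkQ := by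
      intro x hx
      have : C.mkQ x = 0 := (Submodule.Quotient.mk_eq_zero C).2 hx
      simp [Submodule.mem_comap, this]
    have h3 : K.comap C.mkQ = C := le_antisymm (hCmax.le_of_ge h1 h2) h2
    rw [Submodule.eq_bot_iff]
    intro y hy
    obtain ⟨x, rfl⟩ := C.mkQ_surjective y
    have : x ∈ K.comap C.mkQ := hy
    rw [h3] at this
    exact (Submodule.Quotient.mk_eq_zero C).2 this
  have hψ' : ∀ x ∈ E, ψ (C.mkQ x) = x := fun x hx => hψ ⟨x, hx⟩
  have hψinj : LinearMap.ker ψ = ⊥ := key _ fun x hx h => by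
    rw [LinearMap.mem_ker, hψ' x hx] at h
    exact h
  have hEle : E ≤ LinearMap.range ψ := fun x hx => ⟨C.mkQ x, hψ' x hx⟩
  -- by maximality the range of `ψ` is `E`, so `E` is a retract of `J`
  have hrange : LinearMap.range ψ ≤ E := by
    refine hEmax.le_of_ge ⟨hEmax.prop.1.trans hEle, ?_⟩ hEle
    intro L hL hNL
    have h1 : L ⊓ E = ⊥ := hEess _ inf_le_right
      (le_bot_iff.1 ((inf_le_inf_left N inf_le_left).trans hNL.le))
    have h2 : L.comap ψ = ⊥ := key _ fun x hx h => by
      have h3 : ψ (C.mkQ x) ∈ L := h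
      rw [hψ' x hx] at h3
      exact (Submodule.mem_bot R).1 (h1 ▸ Submodule.mem_inf.2 ⟨h3, hx⟩)
    rw [Submodule.eq_bot_iff]
    intro x hx
    obtain ⟨y, rfl⟩ := hL hx
    have h4 : y ∈ L.comap ψ := hx
    rw [h2, Submodule.mem_bot] at h4
    simp [h4]
  refine ⟨E, ⟨?_⟩, hEmax.prop.1, hEess⟩
  intro X Y _ _ _ _ f hf g
  obtain ⟨h, hh⟩ := hJ.out f hf (E.subtype ∘ₗ g)
  refine ⟨(ψ ∘ₗ C.mkQ).codRestrict E (fun x => hrange ⟨_, rfl⟩) ∘ₗ h, fun x => ?_⟩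
  apply Subtype.ext
  change ψ (C.mkQ (h (f x))) = _
  rw [hh x]
  exact hψ' _ (g x).2

theorem nonempty_injectiveEnvelope (M : Type u) [AddCommGroup M] [Module R M] :
    Nonempty (InjectiveEnvelope R M) := by
  obtain ⟨⟨J, hJ, i, hi⟩⟩ := EnoughInjectives.presentation (ModuleCat.of R M)
  have hJ' : Module.Injective R J := Module.injective_module_of_injective_object R J
  have hii : Function.Injective i.hom := (ModuleCat.mono_iff_injective i).1 hi
  obtain ⟨E, hE, hle, hess⟩ := exists_envelope_submodule (LinearMap.range i.hom)
  refine ⟨{ E := E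
            ι := i.hom.codRestrict E (fun x => hle ⟨x, rfl⟩)
            injective := hE
            ι_injective := fun x y h => hii (congrArg Subtype.val h)
            essential := ?_ }⟩
  intro L hL
  have h1 : L.map E.subtype = ⊥ := by
    refine hess _ (Submodule.map_subtype_le E L) ?_
    rw [Submodule.eq_bot_iff]
    rintro x ⟨⟨m, rfl⟩, ⟨y, hy, hyx⟩⟩
    have h2 : y ∈ LinearMap.range (i.hom.codRestrict E (fun x => hle ⟨x, rfl⟩)) ⊓ L :=
      ⟨⟨m, Subtype.ext hyx.symm⟩, hy⟩
    rw [hL, Submodule.mem_bot] at h2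
    rw [← hyx, h2]
    rfl
  rw [Submodule.eq_bot_iff]
  intro y hy
  have h3 : (y : E).1 ∈ L.map E.subtype := ⟨y, hy, rfl⟩
  rw [h1, Submodule.mem_bot] at h3
  exact Subtype.ext h3

variable (R) in
/-- The injective envelope of `M` (unique up to isomorphism; one is chosen). -/
noncomputable def envelope (M : Type u) [AddCommGroup M] [Module R M] : InjectiveEnvelope R M :=
  (nonempty_injectiveEnvelope M).some

variable (R) in
/-- `I⁰(M)`, the degree `0` term of the minimal injective resolution
`0 → M → I⁰(M) → I¹(M) → ⋯`: the injective envelope of `M`. -/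
abbrev I0 (M : Type u) [AddCommGroup M] [Module R M] : Type u := (envelope R M).E

variable (R) in
/-- The first cosyzygy of `M`: the cokernel of `M → I⁰(M)`. -/
abbrev Cosyzygy (M : Type u) [AddCommGroup M] [Module R M] : Type u :=
  I0 R M ⧸ LinearMap.range (envelope R M).ι

variable (R) in
/-- `I¹(M)`, the degree `1` term of the minimal injective resolution: the injective envelope
of the first cosyzygy. -/
abbrev I1 (M : Type u) [AddCommGroup M] [Module R M] : Type u :=
  (envelope R (Cosyzygy R M)).E

variable (R) in
/-- The differential `f⁰ : I⁰(M) → I¹(M)` of the minimal injective resolution of `M`. -/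
noncomputable def f0 (M : Type u) [AddCommGroup M] [Module R M] : I0 R M →ₗ[R] I1 R M :=
  (envelope R (Cosyzygy R M)).ι ∘ₗ (LinearMap.range (envelope R M).ι).mkQ

end Envelope

/-! ## The functors `Hom_R(ω, -)` and `ω ⊗_S -`

A right `S`-module is a left `Sᵐᵒᵖ`-module: `x s` is `MulOpposite.op s • x`. -/

section Bimodule

variable (R S : Type u) [Ring R] [Ring S]
variable (ω : Type u) [AddCommGroup ω] [Module R ω] [Module Sᵐᵒᵖ ω] [SMulCommClass R Sᵐᵒᵖ ω]

/-- Left multiplication by `r : R` as an endomorphism of the right `S`-module `ω`. -/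
def leftMul (r : R) : ω →ₗ[Sᵐᵒᵖ] ω where
  toFun x := r • x
  map_add' := smul_add r
  map_smul' s x := smul_comm r s x

/-- Right multiplication by `s : S` as an endomorphism of the left `R`-module `ω`. -/
def rightMul (s : S) : ω →ₗ[R] ω where
  toFun x := MulOpposite.op s • x
  map_add' := smul_add _
  map_smul' r x := (smul_comm r (MulOpposite.op s) x).symm

/-- `M_* = Hom_R(ω, M)`, a left `S`-module through `(s f)(x) = f(x s)`. -/
def HomStar (M : Type u) [AddCommGroup M] [Module R M] : Type u := ω →ₗ[R] M

instance (M : Type u) [AddCommGroup M] [Module R M] : AddCommGroup (HomStar R ω M) :=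
  inferInstanceAs (AddCommGroup (ω →ₗ[R] M))

instance (M : Type u) [AddCommGroup M] [Module R M] : FunLike (HomStar R ω M) ω M :=
  inferInstanceAs (FunLike (ω →ₗ[R] M) ω M)

instance (M : Type u) [AddCommGroup M] [Module R M] : Module S (HomStar R ω M) where
  smul s f := LinearMap.comp (show ω →ₗ[R] M from f) (rightMul R S ω s)
  one_smul f := LinearMap.ext fun x =>
    congrArg f (show MulOpposite.op (1 : S) • x = x by rw [MulOpposite.op_one, one_smul])
  mul_smul s t f := LinearMap.ext fun x =>
    congrArg f (show MulOpposite.op (s * t) • x = MulOpposite.op t • MulOpposite.op s • x by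
      rw [MulOpposite.op_mul, mul_smul])
  smul_zero _ := LinearMap.ext fun _ => rfl
  smul_add _ _ _ := LinearMap.ext fun _ => rfl
  add_smul s t f := LinearMap.ext fun x =>
    (congrArg f (show MulOpposite.op (s + t) • x = MulOpposite.op s • x + MulOpposite.op t • x by
      rw [MulOpposite.op_add, add_smul])).trans (LinearMap.map_add (show ω →ₗ[R] M from f) _ _)
  zero_smul f := LinearMap.ext fun x =>
    (congrArg f (show MulOpposite.op (0 : S) • x = 0 by
      rw [MulOpposite.op_zero, zero_smul])).trans (LinearMap.map_zero (show ω →ₗ[R] M from f))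

/-- The `S`-linear map `g_* : M_* → N_*`, `f ↦ g ∘ f`. -/
def HomStar.map {M N : Type u} [AddCommGroup M] [Module R M] [AddCommGroup N] [Module R N]
    (g : M →ₗ[R] N) : HomStar R ω M →ₗ[S] HomStar R ω N where
  toFun f := (LinearMap.comp g (show ω →ₗ[R] M from f) : ω →ₗ[R] N)
  map_add' f f' := LinearMap.comp_add (show ω →ₗ[R] M from f) (show ω →ₗ[R] M from f') g
  map_smul' _ _ := rfl

end Bimodule

section Tensor

variable (R S : Type u) [Ring R] [Ring S]
variable (ω : Type u) [AddCommGroup ω] [Module R ω] [Module Sᵐᵒᵖ ω]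

/-- The relations `(x s) ⊗ y = x ⊗ (s y)`; they form a set stable under `R`. -/
def tensorRel (N : Type u) [AddCommGroup N] [Module S N] : Submodule R (ω ⊗[ℤ] N) :=
  Submodule.span R {t | ∃ (x : ω) (s : S) (y : N),
    t = (MulOpposite.op s • x) ⊗ₜ[ℤ] y - x ⊗ₜ[ℤ] (s • y)}

/-- The left `R`-module `ω ⊗_S N`: the quotient of `ω ⊗_ℤ N` by the relations
`(x s) ⊗ y = x ⊗ (s y)`. -/
abbrev Tensor (N : Type u) [AddCommGroup N] [Module S N] : Type u :=
  (ω ⊗[ℤ] N) ⧸ tensorRel R S ω N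

/-- The pure tensor `x ⊗ y` in `ω ⊗_S N`. -/
def tmul {N : Type u} [AddCommGroup N] [Module S N] (x : ω) (y : N) : Tensor R S ω N :=
  (tensorRel R S ω N).mkQ (x ⊗ₜ[ℤ] y)

/-- The `R`-linear map `ω ⊗_S g`, `x ⊗ y ↦ x ⊗ g y`. -/
noncomputable def Tensor.map {N N' : Type u} [AddCommGroup N] [Module S N]
    [AddCommGroup N'] [Module S N'] (g : N →ₗ[S] N') : Tensor R S ω N →ₗ[R] Tensor R S ω N' :=
  Submodule.mapQ _ _
    (TensorProduct.AlgebraTensorModule.map (LinearMap.id : ω →ₗ[R] ω)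
      (g.toAddMonoidHom.toIntLinearMap)) (by
    rw [tensorRel, Submodule.span_le]
    rintro _ ⟨x, s, y, rfl⟩
    refine Submodule.subset_span ⟨x, s, g y, ?_⟩
    simp)

theorem Tensor.map_tmul {N N' : Type u} [AddCommGroup N] [Module S N]
    [AddCommGroup N'] [Module S N'] (g : N →ₗ[S] N') (x : ω) (y : N) :
    Tensor.map R S ω g (tmul R S ω x y) = tmul R S ω x (g y) := rfl

theorem Tensor.hom_ext {N : Type u} [AddCommGroup N] [Module S N] {P : Type u} [AddCommGroup P]
    [Module R P] {a b : Tensor R S ω N →ₗ[R] P}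
    (h : ∀ x y, a (tmul R S ω x y) = b (tmul R S ω x y)) : a = b := by
  apply Submodule.linearMap_qext
  apply TensorProduct.AlgebraTensorModule.ext
  exact h

theorem tmul_add {N : Type u} [AddCommGroup N] [Module S N] (x : ω) (y z : N) :
    tmul R S ω x (y + z) = tmul R S ω x y + tmul R S ω x z := by
  simp [tmul, TensorProduct.tmul_add]

/-- The functor `ω ⊗_S - : Mod S ⥤ Mod R`. -/
noncomputable def tensorFunctor : ModuleCat.{u} S ⥤ ModuleCat.{u} R where
  obj N := ModuleCat.of R (Tensor R S ω N)
  map g := ModuleCat.ofHom (Tensor.map R S ω g.hom)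
  map_id _ := ModuleCat.hom_ext (Tensor.hom_ext R S ω fun _ _ => rfl)
  map_comp _ _ := ModuleCat.hom_ext (Tensor.hom_ext R S ω fun _ _ => rfl)

instance : (tensorFunctor R S ω).Additive where
  map_add {_ _ f g} := ModuleCat.hom_ext (Tensor.hom_ext R S ω fun x y =>
    tmul_add R S ω x (f.hom y) (g.hom y))

/-- `Tor_i^S(ω, N)`: the `i`-th left derived functor of `ω ⊗_S -` at `N` (with the left
`R`-module structure induced from `ω`). -/
noncomputable def Tor (i : ℕ) (N : Type u) [AddCommGroup N] [Module S N] : ModuleCat.{u} R :=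
  ((tensorFunctor R S ω).leftDerived i).obj (ModuleCat.of S N)

end Tensor

section Classes

variable (R S : Type u) [Ring R] [Ring S]
variable (ω : Type u) [AddCommGroup ω] [Module R ω] [Module Sᵐᵒᵖ ω] [SMulCommClass R Sᵐᵒᵖ ω]

/-- The evaluation map `θ_M : ω ⊗_S M_* → M`, `x ⊗ f ↦ f x`. -/
noncomputable def theta (M : Type u) [AddCommGroup M] [Module R M] :
    Tensor R S ω (HomStar R ω M) →ₗ[R] M :=
  Submodule.liftQ _
    (TensorProduct.AlgebraTensorModule.lift
      { toFun := fun x => (show (HomStar R ω M) →+ M from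
          { toFun := fun f => f x, map_zero' := rfl, map_add' := fun _ _ => rfl }).toIntLinearMap
        map_add' := fun x y => LinearMap.ext fun f =>
          LinearMap.map_add (show ω →ₗ[R] M from f) x y
        map_smul' := fun r x => LinearMap.ext fun f =>
          LinearMap.map_smul (show ω →ₗ[R] M from f) r x }) (by
    rw [tensorRel, Submodule.span_le]
    rintro _ ⟨x, s, f, rfl⟩
    exact (LinearMap.mem_ker).2 ((map_sub _ _ _).trans (sub_eq_zero.2 rfl)))

theorem theta_tmul (M : Type u) [AddCommGroup M] [Module R M] (x : ω) (f : HomStar R ω M) :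
    theta R S ω M (tmul R S ω x f) = f x := rfl

/-! ## Semidualizing bimodules and the classes of modules attached to them -/

/-- A left module over `A` admits a degreewise finite projective resolution: a resolution by
finitely generated projective modules. -/
def HasDegreewiseFiniteResolution (A : Type u) [Ring A] (M : Type u) [AddCommGroup M]
    [Module A M] : Prop :=
  ∃ P : ProjectiveResolution (ModuleCat.of A M), ∀ n, Module.Finite A (P.complex.X n)

/-- `ω` is a semidualizing `(R, S)`-bimodule. -/
structure IsSemidualizing : Prop where
  a1 : HasDegreewiseFiniteResolution R ω
  a2 : HasDegreewiseFiniteResolution Sᵐᵒᵖ ω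
  b1 : Function.Bijective (leftMul R S ω)
  b2 : Function.Bijective (rightMul R S ω)
  c1 : ∀ i : ℕ, 1 ≤ i → Subsingleton (Abelian.Ext (ModuleCat.of R ω) (ModuleCat.of R ω) i)
  c2 : ∀ i : ℕ, 1 ≤ i → Subsingleton (Abelian.Ext (ModuleCat.of Sᵐᵒᵖ ω) (ModuleCat.of Sᵐᵒᵖ ω) i)

/-- The right orthogonal class `_Rω^⊥` of left `R`-modules `M` with `Ext_R^i(ω, M) = 0` for all
`i ≥ 1`. -/
def rightPerp : ObjectProperty (ModuleCat.{u} R) := fun M =>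
  ∀ i : ℕ, 1 ≤ i → Subsingleton (Abelian.Ext (ModuleCat.of R ω) M i)

/-- The Bass class `B_ω(R)`. -/
def bassClass : ObjectProperty (ModuleCat.{u} R) := fun M =>
  rightPerp R ω M ∧
  (∀ i : ℕ, 1 ≤ i → Limits.IsZero (Tor R S ω i (HomStar R ω M))) ∧
  Function.Bijective (theta R S ω M)

/-- The cotranspose `cTr_ω M`: the cokernel of `(f⁰)_* : I⁰(M)_* → I¹(M)_*`, a left
`S`-module. -/
abbrev Cotranspose (M : Type u) [AddCommGroup M] [Module R M] : Type u :=
  HomStar R ω (I1 R M) ⧸ LinearMap.range (HomStar.map R S ω (f0 R M))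

/-- `M` is `n`-`ω`-cotorsionfree: `Tor_i^S(ω, cTr_ω M) = 0` for `1 ≤ i ≤ n`. -/
def IsCotorsionfree (n : ℕ) (M : Type u) [AddCommGroup M] [Module R M] : Prop :=
  ∀ i : ℕ, 1 ≤ i → i ≤ n → Limits.IsZero (Tor R S ω i (Cotranspose R S ω M))

/-- The class `cT(R)` of `∞`-`ω`-cotorsionfree modules: those that are `n`-`ω`-cotorsionfree for
all `n`. -/
def cotorsionfreeClass : ObjectProperty (ModuleCat.{u} R) := fun M =>
  ∀ n : ℕ, IsCotorsionfree R S ω n M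

end Classes

end Semidualizing

/-! Write `ω⁺` for the character module of `ω`. Since `ℚ/ℤ` is an injective cogenerator and `(ω ⊗_S
N)⁺ ≅ Hom_S(N, ω⁺)`, the vanishing of `Tor_i^S(ω, N)` is the vanishing of `Ext_S^i(N, ω⁺)`
(`isZero_tor_iff`), and `θ_M` is bijective exactly when its transpose `M⁺ → Hom_S(M_*, ω⁺)` is
(`thetaDual_bijective_iff`). Everything about `ω ⊗_S -` thus becomes extending or lifting maps, and
long exact sequences are only needed for Ext. Call `N` acyclic if these groups vanish for all `i ≥
1`.

If `I` is injective, then `θ_I` is bijective and `I_*` is acyclic. This is Hom evaluation: `W ⊗_S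
Hom_R(ω, I)` is compared with `Hom_R(Hom_{Sᵒᵖ}(W, ω), I)` for `W` with enough finite generation
(`pairing`), then `W = ω`. Comparing `0 → M_* → I⁰(M)_* → I¹(M)_* → cTr_ω M → 0` with `0 → M → I⁰(M)
→ I¹(M)` shows that `cTr_ω M` is acyclic iff `M_*` is acyclic and `θ_M` is bijective
(`cokernel_acyclic_iff`). Hence the Bass class is the intersection of `_Rω^⊥` and `cT(R)`, and only
the two inclusions remain.

For the first, `M ≅ ω ⊗_S M_*` with `M_*` acyclic, so tensoring a free resolution of `M_*` with `ω`
resolves `M` by direct sums of copies of `ω`, which are `Ext_R(ω, -)`-acyclic. Shifting along it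
reaches degrees above `pd_R ω` (`extVanishes_tensor`). For the second, if `M ∈ _Rω^⊥` then `Hom_R(ω,
-)` keeps its injective resolution exact, and shifting along cosyzygies reaches degrees above the
injective dimension of `ω⁺`, which is at most `pd_{Sᵒᵖ} ω` (`acyclic_homStar_of_rightPerp`);
moreover `cTr_ω M` is `Hom_R(ω, -)` of the second cosyzygy. -/

namespace Semidualizing

/-! ### Dimension shifting for Ext, and finiteness of syzygies. -/

section ExtVanishing

variable {A : Type u} [Ring A]

/-- Vanishing of `Ext^i_A(M, N)`. -/
abbrev ExtVanishes (A : Type u) [Ring A] (M N : Type u) [AddCommGroup M] [Module A M]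
    [AddCommGroup N] [Module A N] (i : ℕ) : Prop :=
  Subsingleton (Abelian.Ext (ModuleCat.of A M) (ModuleCat.of A N) i)


variable {M K P W N : Type u} [AddCommGroup M] [Module A M] [AddCommGroup K] [Module A K]
  [AddCommGroup P] [Module A P] [AddCommGroup W] [Module A W] [AddCommGroup N] [Module A N]

theorem exists_shortExact {f : K →ₗ[A] P} {g : P →ₗ[A] W} (hf : Function.Injective f)
    (hg : Function.Surjective g) (hfg : Function.Exact f g) :
    ∃ w : ModuleCat.ofHom f ≫ ModuleCat.ofHom g = 0,
      (ShortComplex.mk (ModuleCat.ofHom f) (ModuleCat.ofHom g) w).ShortExact := by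
  have w : ModuleCat.ofHom f ≫ ModuleCat.ofHom g = 0 := by
    ext x
    exact hfg.apply_apply_eq_zero x
  exact ⟨w,
    { exact := (ShortComplex.ShortExact.moduleCat_exact_iff_function_exact _).2 hfg
      mono_f := (ModuleCat.mono_iff_injective _).2 hf
      epi_g := (ModuleCat.epi_iff_surjective _).2 hg }⟩

namespace ExtVanishes

theorem of_projective [Module.Projective A P] (i : ℕ) : ExtVanishes A P N (i + 1) :=
  have : Projective (ModuleCat.of A P) := (IsProjective.iff_projective P).1 inferInstance
  Abelian.Ext.subsingleton_of_projective _ _ _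

theorem of_injective [Module.Injective A N] (i : ℕ) : ExtVanishes A M N (i + 1) :=
  have : Injective (ModuleCat.of A N) := Module.injective_object_of_injective_module A N
  Abelian.Ext.subsingleton_of_injective _ _ _

theorem congr_left (e : M ≃ₗ[A] W) {i : ℕ} (h : ExtVanishes A M N i) : ExtVanishes A W N i := by
  refine subsingleton_of_forall_eq 0 fun x => ?_
  generalize e.toModuleIso = φ
  have h1 : (Abelian.Ext.mk₀ φ.hom).comp x (zero_add i) = 0 := Subsingleton.elim _ _
  have h2 := congrArg (fun y => (Abelian.Ext.mk₀ φ.inv).comp y (zero_add i)) h1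
  simpa using h2

theorem congr_right (e : N ≃ₗ[A] W) {i : ℕ} (h : ExtVanishes A M N i) : ExtVanishes A M W i := by
  refine subsingleton_of_forall_eq 0 fun x => ?_
  generalize e.toModuleIso = φ
  have h1 : x.comp (Abelian.Ext.mk₀ φ.inv) (add_zero i) = 0 := Subsingleton.elim _ _
  have h2 := congrArg (fun y => y.comp (Abelian.Ext.mk₀ φ.hom) (add_zero i)) h1
  simpa using h2

variable {f : K →ₗ[A] P} {g : P →ₗ[A] W}

/-- Dimension shifting: in this lemma and the next three the Ext group in question sits between two
vanishing groups of the long exact sequence of `0 → K → P → W → 0`. `left`/`right` names the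
argument of Ext in which the sequence is placed, `first`/`third` the term whose Ext is shown to
vanish. -/
theorem left_third (hf : Function.Injective f) (hg : Function.Surjective g)
    (hfg : Function.Exact f g) {i : ℕ} (hK : ExtVanishes A K N i)
    (hP : ExtVanishes A P N (i + 1)) : ExtVanishes A W N (i + 1) := by
  obtain ⟨w, hS⟩ := exists_shortExact hf hg hfg
  refine subsingleton_of_forall_eq 0 fun x => ?_
  obtain ⟨y, rfl⟩ := Abelian.Ext.contravariant_sequence_exact₃ hS _ x
    (hP.elim _ _) (add_comm 1 i)
  rw [hK.elim y 0, Abelian.Ext.comp_zero]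

theorem left_first (hf : Function.Injective f) (hg : Function.Surjective g)
    (hfg : Function.Exact f g) {i : ℕ} (hP : ExtVanishes A P N i)
    (hW : ExtVanishes A W N (i + 1)) : ExtVanishes A K N i := by
  obtain ⟨w, hS⟩ := exists_shortExact hf hg hfg
  refine subsingleton_of_forall_eq 0 fun x => ?_
  obtain ⟨y, rfl⟩ := Abelian.Ext.contravariant_sequence_exact₁ hS _ x (add_comm 1 i)
    (hW.elim _ _)
  rw [hP.elim y 0, Abelian.Ext.comp_zero]

theorem right_first (hf : Function.Injective f) (hg : Function.Surjective g)
    (hfg : Function.Exact f g) {i : ℕ} (hW : ExtVanishes A M W i)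
    (hP : ExtVanishes A M P (i + 1)) : ExtVanishes A M K (i + 1) := by
  obtain ⟨w, hS⟩ := exists_shortExact hf hg hfg
  refine subsingleton_of_forall_eq 0 fun x => ?_
  obtain ⟨y, rfl⟩ := Abelian.Ext.covariant_sequence_exact₁ _ hS x (hP.elim _ _) rfl
  rw [hW.elim y 0, Abelian.Ext.zero_comp]

theorem right_third (hf : Function.Injective f) (hg : Function.Surjective g)
    (hfg : Function.Exact f g) {i : ℕ} (hP : ExtVanishes A M P i)
    (hK : ExtVanishes A M K (i + 1)) : ExtVanishes A M W i := by
  obtain ⟨w, hS⟩ := exists_shortExact hf hg hfg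
  refine subsingleton_of_forall_eq 0 fun x => ?_
  obtain ⟨y, rfl⟩ := Abelian.Ext.covariant_sequence_exact₃ _ hS x rfl (hK.elim _ _)
  rw [hP.elim y 0, Abelian.Ext.zero_comp]

theorem exists_extension (hf : Function.Injective f) (hg : Function.Surjective g)
    (hfg : Function.Exact f g) (hW : ExtVanishes A W N 1) (h : K →ₗ[A] N) :
    ∃ e : P →ₗ[A] N, e ∘ₗ f = h := by
  obtain ⟨w, hS⟩ := exists_shortExact hf hg hfg
  obtain ⟨y, hy⟩ := Abelian.Ext.contravariant_sequence_exact₁ hS _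
    (Abelian.Ext.mk₀ (ModuleCat.ofHom h)) (add_zero 1) (hW.elim _ _)
  obtain ⟨e, rfl⟩ := (Abelian.Ext.mk₀_bijective _ _).2 y
  rw [Abelian.Ext.mk₀_comp_mk₀] at hy
  exact ⟨e.hom, congrArg ModuleCat.Hom.hom ((Abelian.Ext.mk₀_bijective _ _).1 hy)⟩

theorem exists_lift (hf : Function.Injective f) (hg : Function.Surjective g)
    (hfg : Function.Exact f g) (hK : ExtVanishes A M K 1) (h : M →ₗ[A] W) :
    ∃ e : M →ₗ[A] P, g ∘ₗ e = h := by
  obtain ⟨w, hS⟩ := exists_shortExact hf hg hfg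
  obtain ⟨y, hy⟩ := Abelian.Ext.covariant_sequence_exact₃ _ hS
    (Abelian.Ext.mk₀ (ModuleCat.ofHom h)) (zero_add 1) (hK.elim _ _)
  obtain ⟨e, rfl⟩ := (Abelian.Ext.mk₀_bijective _ _).2 y
  rw [Abelian.Ext.mk₀_comp_mk₀] at hy
  exact ⟨e.hom, congrArg ModuleCat.Hom.hom ((Abelian.Ext.mk₀_bijective _ _).1 hy)⟩

/-- Converse of `exists_extension`: every class in `Ext¹(W, N)` comes from some `K → N` through the
connecting map, which kills the maps that extend to `P`. -/
theorem one_of_extension (hf : Function.Injective f) (hg : Function.Surjective g)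
    (hfg : Function.Exact f g) (hP : ExtVanishes A P N 1)
    (h : ∀ h : K →ₗ[A] N, ∃ e : P →ₗ[A] N, e ∘ₗ f = h) : ExtVanishes A W N 1 := by
  obtain ⟨w, hS⟩ := exists_shortExact hf hg hfg
  refine subsingleton_of_forall_eq 0 fun x => ?_
  obtain ⟨y, rfl⟩ := Abelian.Ext.contravariant_sequence_exact₃ hS _ x
    (hP.elim _ _) (add_zero 1)
  obtain ⟨k, rfl⟩ := (Abelian.Ext.mk₀_bijective _ _).2 y
  obtain ⟨e, he⟩ := h k.hom
  have hk : k = ModuleCat.ofHom f ≫ ModuleCat.ofHom e := by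
    ext x
    exact (LinearMap.congr_fun he x).symm
  rw [hk, ← Abelian.Ext.mk₀_comp_mk₀]
  exact hS.extClass_comp_assoc _

theorem one_of_lift (hf : Function.Injective f) (hg : Function.Surjective g)
    (hfg : Function.Exact f g) (hP : ExtVanishes A M P 1)
    (h : ∀ h : M →ₗ[A] W, ∃ e : M →ₗ[A] P, g ∘ₗ e = h) : ExtVanishes A M K 1 := by
  obtain ⟨w, hS⟩ := exists_shortExact hf hg hfg
  refine subsingleton_of_forall_eq 0 fun x => ?_
  obtain ⟨y, rfl⟩ := Abelian.Ext.covariant_sequence_exact₁ _ hS x (hP.elim _ _) (zero_add 1)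
  obtain ⟨k, rfl⟩ := (Abelian.Ext.mk₀_bijective _ _).2 y
  obtain ⟨e, he⟩ := h k.hom
  have hk : k = ModuleCat.ofHom e ≫ ModuleCat.ofHom g := by
    ext x
    exact (LinearMap.congr_fun he x).symm
  rw [hk, ← Abelian.Ext.mk₀_comp_mk₀]
  rw [Abelian.Ext.comp_assoc _ _ _ (add_zero 0) (zero_add 1) (by simp)]
  exact (congrArg (fun z => (Abelian.Ext.mk₀ (ModuleCat.ofHom e)).comp z (zero_add 1))
    hS.comp_extClass).trans (Abelian.Ext.comp_zero _ _ _ _ _)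

end ExtVanishes

/-- A module with a finite projective resolution of length up to `n` by finitely generated
projective modules and a finitely generated `n`-th syzygy. -/
def IsFP : ℕ → ∀ (A : Type u) [Ring A] (M : Type u) [AddCommGroup M] [Module A M], Prop
  | 0, A, _, M, _, _ => Module.Finite A M
  | n + 1, A, _, M, _, _ => ∃ (P K : ModuleCat.{u} A) (f : K →ₗ[A] P) (g : P →ₗ[A] M),
      Function.Injective f ∧ Function.Surjective g ∧ Function.Exact f g ∧
      Module.Projective A P ∧ Module.Finite A P ∧ IsFP n A K

theorem IsFP.finite {n : ℕ} (h : IsFP n A M) : Module.Finite A M := by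
  cases n with
  | zero => exact h
  | succ n =>
    obtain ⟨P, K, f, g, -, hg, -, -, hP, -⟩ := h
    exact Module.Finite.of_surjective g hg

theorem HasDegreewiseFiniteResolution.isFP (h : HasDegreewiseFiniteResolution A M) (n : ℕ) :
    IsFP n A M := by
  obtain ⟨P, hP⟩ := h
  have hproj : ∀ m, Module.Projective A (P.complex.X m) := fun m =>
    (IsProjective.iff_projective _).2 (P.projective m)
  -- Uniform in `m`, because peeling off one projective replaces the image of one differential by
  -- the image of the next.
  have syz : ∀ n m, IsFP n A (LinearMap.range (P.complex.d (m + 1) m).hom) := by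
    intro n
    induction n with
    | zero =>
      intro m
      have := hP (m + 1)
      exact (inferInstance : Module.Finite A (LinearMap.range (P.complex.d (m + 1) m).hom))
    | succ n ih =>
      intro m
      refine ⟨P.complex.X (m + 1), ModuleCat.of A (LinearMap.range (P.complex.d (m + 2) (m + 1)).hom),
        Submodule.subtype _, LinearMap.rangeRestrict _, Subtype.val_injective,
        LinearMap.surjective_rangeRestrict _, ?_, hproj _, hP _, ih _⟩
      rw [LinearMap.exact_iff, LinearMap.ker_rangeRestrict, Submodule.range_subtype]
      exact ((ShortComplex.moduleCat_exact_iff_range_eq_ker _).1 (P.exact_succ m)).symm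
  let ε : P.complex.X 0 →ₗ[A] M := (P.π.f 0).hom
  have hε : Function.Surjective ε := (ModuleCat.epi_iff_surjective (P.π.f 0)).1 inferInstance
  have hker : LinearMap.ker ε = LinearMap.range (P.complex.d 1 0).hom :=
    ((ShortComplex.moduleCat_exact_iff_range_eq_ker _).1 P.exact₀).symm
  cases n with
  | zero =>
    have := hP 0
    exact Module.Finite.of_surjective ε hε
  | succ n =>
    refine ⟨P.complex.X 0, ModuleCat.of A (LinearMap.range (P.complex.d 1 0).hom),
      Submodule.subtype _, ε, Subtype.val_injective, hε, ?_, hproj _, hP _, syz _ _⟩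
    rw [LinearMap.exact_iff, Submodule.range_subtype, hker]

end ExtVanishing

/-! ### Injectivity and cogeneration of `ℚ/ℤ`. -/

section Characters

/-- The character factors through `B ⧸ ker f`, which embeds in `C`; injectivity of `ℚ/ℤ` does the
rest. -/
theorem exists_character_extension {B C : Type*} [AddCommGroup B] [AddCommGroup C] (f : B →+ C)
    (φ : CharacterModule B) (h : ∀ b, f b = 0 → φ b = 0) :
    ∃ ψ : CharacterModule C, ∀ b, ψ (f b) = φ b := by
  let φ' : CharacterModule (B ⧸ f.ker) := QuotientAddGroup.lift f.ker φ h
  obtain ⟨ψ, hψ⟩ := CharacterModule.dual_surjective_of_injective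
    (QuotientAddGroup.kerLift f).toIntLinearMap (QuotientAddGroup.kerLift_injective f) φ'
  exact ⟨ψ, fun b => DFunLike.congr_fun hψ (QuotientAddGroup.mk b)⟩

/-- Characters separate the points of `C ⧸ range f`. -/
theorem mem_range_of_characters {B C : Type*} [AddCommGroup B] [AddCommGroup C] (f : B →+ C) {c : C}
    (h : ∀ ψ : CharacterModule C, (∀ b, ψ (f b) = 0) → ψ c = 0) : ∃ b, f b = c := by
  have h0 : (QuotientAddGroup.mk c : C ⧸ f.range) = 0 := by
    refine CharacterModule.eq_zero_of_character_apply fun χ => ?_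
    refine h (show CharacterModule C from
      AddMonoidHom.comp χ (QuotientAddGroup.mk' f.range)) fun b => ?_
    have : (QuotientAddGroup.mk (f b) : C ⧸ f.range) = 0 :=
      (QuotientAddGroup.eq_zero_iff _).2 ⟨b, rfl⟩
    exact (congrArg χ this).trans (map_zero χ)
  exact (QuotientAddGroup.eq_zero_iff c).1 h0

theorem exists_injective_extension {A : Type u} [Ring A] {B C I : Type u} [AddCommGroup B]
    [Module A B] [AddCommGroup C] [Module A C] [AddCommGroup I] [Module A I]
    [hI : Module.Injective A I] (f : B →ₗ[A] C) (h : B →ₗ[A] I)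
    (hfh : LinearMap.ker f ≤ LinearMap.ker h) : ∃ k : C →ₗ[A] I, k ∘ₗ f = h := by
  obtain ⟨k, hk⟩ := hI.out ((LinearMap.ker f).liftQ f le_rfl)
    (LinearMap.ker_eq_bot.1 (Submodule.ker_liftQ_eq_bot _ _ _ le_rfl))
    ((LinearMap.ker f).liftQ h hfh)
  exact ⟨k, LinearMap.ext fun b => hk (Submodule.Quotient.mk b)⟩

end Characters

/-! ### Character modules of right `S`-modules as an exact contravariant functor. -/

section CharDual

variable (S : Type u)

/-- The character module `W⁺ = Hom_ℤ(W, ℚ/ℤ)` of a right `S`-module `W`, a left `S`-module through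
`(s c)(w) = c(w s)`. -/
def CharDual (_S W : Type u) [AddCommGroup W] : Type u := CharacterModule W

variable (W : Type u) [AddCommGroup W]

instance : AddCommGroup (CharDual S W) := inferInstanceAs (AddCommGroup (CharacterModule W))

instance : FunLike (CharDual S W) W (AddCircle (1 : ℚ)) :=
  inferInstanceAs (FunLike (CharacterModule W) W (AddCircle (1 : ℚ)))

instance : AddMonoidHomClass (CharDual S W) W (AddCircle (1 : ℚ)) :=
  inferInstanceAs (AddMonoidHomClass (W →+ AddCircle (1 : ℚ)) W (AddCircle (1 : ℚ)))

instance [Ring S] [Module Sᵐᵒᵖ W] : Module S (CharDual S W) where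
  smul s c := (AddMonoidHom.comp (show W →+ AddCircle (1 : ℚ) from c)
    (DistribSMul.toAddMonoidHom W (MulOpposite.op s)) : W →+ AddCircle (1 : ℚ))
  one_smul c := DFunLike.ext _ _ fun w =>
    congrArg c (show MulOpposite.op (1 : S) • w = w by rw [MulOpposite.op_one, one_smul])
  mul_smul s t c := DFunLike.ext _ _ fun w =>
    congrArg c (show MulOpposite.op (s * t) • w = MulOpposite.op t • MulOpposite.op s • w by
      rw [MulOpposite.op_mul, mul_smul])
  smul_zero _ := rfl
  smul_add _ _ _ := rfl
  add_smul s t c := DFunLike.ext _ _ fun w =>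
    (congrArg c (show MulOpposite.op (s + t) • w = MulOpposite.op s • w + MulOpposite.op t • w by
      rw [MulOpposite.op_add, add_smul])).trans (map_add c _ _)
  zero_smul c := DFunLike.ext _ _ fun w =>
    (congrArg c (show MulOpposite.op (0 : S) • w = 0 by
      rw [MulOpposite.op_zero, zero_smul])).trans (map_zero c)

namespace CharDual

variable {S W}

@[ext] theorem ext {c d : CharDual S W} (h : ∀ w, c w = d w) : c = d := DFunLike.ext _ _ h

@[simp] theorem smul_apply [Ring S] [Module Sᵐᵒᵖ W] (s : S) (c : CharDual S W) (w : W) :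
    (s • c) w = c (MulOpposite.op s • w) := rfl

@[simp] theorem add_apply (c d : CharDual S W) (w : W) : (c + d) w = c w + d w := rfl

@[simp] theorem zero_apply (w : W) : (0 : CharDual S W) w = 0 := rfl

variable [Ring S] {V : Type u} [AddCommGroup V] [Module Sᵐᵒᵖ V] [Module Sᵐᵒᵖ W]

/-- The transpose of a map of right `S`-modules. -/
def map (f : V →ₗ[Sᵐᵒᵖ] W) : CharDual S W →ₗ[S] CharDual S V where
  toFun c := (AddMonoidHom.comp (show W →+ AddCircle (1 : ℚ) from c) f.toAddMonoidHom :
    V →+ AddCircle (1 : ℚ))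
  map_add' _ _ := rfl
  map_smul' s c := DFunLike.ext _ _ fun v => congrArg c (f.map_smul (MulOpposite.op s) v).symm

theorem map_injective {f : V →ₗ[Sᵐᵒᵖ] W} (hf : Function.Surjective f) :
    Function.Injective (map f) := fun c d h => ext fun w => by
  obtain ⟨v, rfl⟩ := hf w
  exact DFunLike.congr_fun h v

theorem map_surjective {f : V →ₗ[Sᵐᵒᵖ] W} (hf : Function.Injective f) :
    Function.Surjective (map f) := fun c => by
  obtain ⟨d, hd⟩ := exists_character_extension f.toAddMonoidHom c fun v hv => by
    have : v = 0 := hf (hv.trans (map_zero f).symm)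
    rw [this]
    exact map_zero c
  exact ⟨d, ext hd⟩

theorem map_exact {U : Type u} [AddCommGroup U] [Module Sᵐᵒᵖ U] {f : V →ₗ[Sᵐᵒᵖ] W}
    {g : W →ₗ[Sᵐᵒᵖ] U} (h : Function.Exact f g) : Function.Exact (map g) (map f) := by
  intro c
  refine ⟨fun hc => ?_, ?_⟩
  · obtain ⟨d, hd⟩ := exists_character_extension g.toAddMonoidHom c fun w hw => by
      obtain ⟨v, rfl⟩ := (h w).1 hw
      exact DFunLike.congr_fun hc v
    exact ⟨d, ext hd⟩
  · rintro ⟨d, rfl⟩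
    exact ext fun v => (congrArg d (h.apply_apply_eq_zero v)).trans (map_zero d)

end CharDual

end CharDual

/-! ### Tensor-Hom adjunction with values in `ℚ/ℤ`, and Tor as Ext into `ω⁺`. -/

section TensorDuality

variable (R S : Type u) [Ring R] [Ring S]
variable (ω : Type u) [AddCommGroup ω] [Module R ω] [Module Sᵐᵒᵖ ω]

theorem tmul_add_left {N : Type u} [AddCommGroup N] [Module S N] (x y : ω) (n : N) :
    tmul R S ω (x + y) n = tmul R S ω x n + tmul R S ω y n := by
  simp [tmul, TensorProduct.add_tmul]

theorem tmul_smul {N : Type u} [AddCommGroup N] [Module S N] (s : S) (x : ω) (n : N) :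
    tmul R S ω x (s • n) = tmul R S ω (MulOpposite.op s • x) n := by
  exact ((Submodule.Quotient.eq (tensorRel R S ω N)).2
    (Submodule.subset_span ⟨x, s, n, rfl⟩)).symm

theorem smul_tmul {N : Type u} [AddCommGroup N] [Module S N] (r : R) (x : ω) (n : N) :
    r • tmul R S ω x n = tmul R S ω (r • x) n := rfl

theorem Tensor.induction {N : Type u} [AddCommGroup N] [Module S N]
    {p : Tensor R S ω N → Prop} (tmul : ∀ x n, p (tmul R S ω x n))
    (add : ∀ a b, p a → p b → p (a + b)) (t : Tensor R S ω N) : p t := by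
  obtain ⟨t, rfl⟩ := (tensorRel R S ω N).mkQ_surjective t
  induction t with
  | zero =>
    have h := tmul 0 0
    rwa [Semidualizing.tmul, TensorProduct.tmul_zero] at h
  | tmul x n => exact tmul x n
  | add a b ha hb => rw [map_add]; exact add _ _ ha hb

variable {N : Type u} [AddCommGroup N] [Module S N]

/-- The `S`-linear map `N → ω⁺` attached to a character of `ω ⊗_S N`. -/
def Tensor.curry (c : CharacterModule (Tensor R S ω N)) : N →ₗ[S] CharDual S ω where
  toFun n := AddMonoidHom.mk' (fun x => c (tmul R S ω x n)) fun x y => by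
    rw [tmul_add_left, map_add]
  map_add' n m := CharDual.ext fun x =>
    (congrArg c (tmul_add R S ω x n m)).trans (map_add c _ _)
  map_smul' s n := CharDual.ext fun x => congrArg c (tmul_smul R S ω s x n)

theorem Tensor.curry_apply (c : CharacterModule (Tensor R S ω N)) (n : N) (x : ω) :
    Tensor.curry R S ω c n x = c (tmul R S ω x n) := rfl

variable [SMulCommClass R Sᵐᵒᵖ ω]

theorem Tensor.curry_bijective :
    Function.Bijective (Tensor.curry R S ω : CharacterModule (Tensor R S ω N) → _) := by
  constructor
  · intro c d h
    refine DFunLike.ext _ _ fun t => ?_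
    induction t using Tensor.induction with
    | tmul x n => exact DFunLike.congr_fun (LinearMap.congr_fun h n) x
    | add a b ha hb => rw [map_add, map_add, ha, hb]
  · intro b
    let φ : ω ⊗[ℤ] N →+ AddCircle (1 : ℚ) := TensorProduct.liftAddHom
      (AddMonoidHom.mk' (fun x => AddMonoidHom.mk' (fun n => b n x) fun n m => by
          rw [map_add, CharDual.add_apply])
        fun x y => AddMonoidHom.ext fun n => map_add (b n) x y)
      fun r x n => by
        change b n (r • x) = b (r • n) x
        rw [map_zsmul, map_zsmul]
        exact (AddMonoidHom.zsmul_apply (show ω →+ AddCircle (1 : ℚ) from b n) r x).symm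
    -- `tensorRel` is an `R`-span while `φ` is only additive, so vanishing has to be carried through
    -- the induction for all multiples `r • t`. On generators this uses that the two actions on `ω`
    -- commute.
    have hφ : ∀ t ∈ tensorRel R S ω N, ∀ r : R, φ (r • t) = 0 := by
      intro t ht
      induction ht using Submodule.span_induction with
      | mem t ht =>
        obtain ⟨x, s, n, rfl⟩ := ht
        intro r
        rw [smul_sub, map_sub, sub_eq_zero]
        change b n (r • MulOpposite.op s • x) = b (s • n) (r • x)
        rw [LinearMap.map_smul b, CharDual.smul_apply, smul_comm]
      | zero => intro r; rw [smul_zero, map_zero]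
      | add t t' _ _ h h' => intro r; rw [smul_add, map_add, h, h', add_zero]
      | smul a t _ h => intro r; rw [smul_smul, h]
    refine ⟨(QuotientAddGroup.lift (tensorRel R S ω N).toAddSubgroup φ fun t ht => ?_ :
      Tensor R S ω N →+ AddCircle (1 : ℚ)), ?_⟩
    · simpa using hφ t ht 1
    · ext n x
      rfl

/-- Vanishing of `Tor` in positive degrees, read off from the character module of `ω`. -/
theorem isZero_tor_iff (i : ℕ) :
    Limits.IsZero (Tor R S ω (i + 1) N) ↔ ExtVanishes S N (CharDual S ω) (i + 1) := by
  -- Both sides are computed from this one resolution: a character of `ω ⊗_S P_{i+1}` that kills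
  -- boundaries is the same as a cocycle `P_{i+1} → ω⁺`, and one that factors through `d₁` is a
  -- coboundary.
  let P := projectiveResolution (ModuleCat.of S N)
  let C := ((tensorFunctor R S ω).mapHomologicalComplex (ComplexShape.down ℕ)).obj P.complex
  have h1 : Limits.IsZero (Tor R S ω (i + 1) N) ↔ (C.sc' (i + 2) (i + 1) i).Exact := by
    rw [← C.exactAt_iff' (i + 2) (i + 1) i (by simp) (by simp),
      HomologicalComplex.exactAt_iff_isZero_homology]
    exact (P.isoLeftDerivedObj (tensorFunctor R S ω) (i + 1)).isZero_iff
  rw [h1, ShortComplex.moduleCat_exact_iff]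
  let d₂ := (P.complex.d (i + 2) (i + 1)).hom
  let d₁ := (P.complex.d (i + 1) i).hom
  change (∀ t : Tensor R S ω (P.complex.X (i + 1)), Tensor.map R S ω d₁ t = 0 →
    ∃ t', Tensor.map R S ω d₂ t' = t) ↔ _
  have hdd : ∀ p, d₁ (d₂ p) = 0 := fun p =>
    congrArg (fun k => k.hom p) (P.complex.d_comp_d (i + 2) (i + 1) i)
  constructor
  · intro h
    refine subsingleton_of_forall_eq 0 fun e => ?_
    obtain ⟨f, hf, rfl⟩ := P.extMk_surjective e (i + 2) rfl
    rw [P.extMk_eq_zero_iff _ _ _ _ i rfl]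
    obtain ⟨c, hc⟩ := (Tensor.curry_bijective R S ω).2 f.hom
    have hc2 : ∀ t, c (Tensor.map R S ω d₂ t) = 0 := by
      intro t
      induction t using Tensor.induction with
      | tmul x p =>
        rw [Tensor.map_tmul, ← Tensor.curry_apply, hc]
        have : f.hom (d₂ p) = 0 := congrArg (fun k => k.hom p) hf
        rw [this, CharDual.zero_apply]
      | add a b ha hb => rw [map_add, map_add, ha, hb, add_zero]
    obtain ⟨ψ, hψ⟩ := exists_character_extension (Tensor.map R S ω d₁).toAddMonoidHom c
      fun t ht => by
        obtain ⟨t', rfl⟩ := h t ht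
        exact hc2 t'
    refine ⟨ModuleCat.ofHom (Tensor.curry R S ω ψ), ?_⟩
    refine ModuleCat.hom_ext (LinearMap.ext fun p => ?_)
    change (Tensor.curry R S ω ψ (d₁ p) : CharDual S ω) = f.hom p
    exact CharDual.ext fun x =>
      (hψ (tmul R S ω x p)).trans (DFunLike.congr_fun (LinearMap.congr_fun hc p) x)
  · intro h t ht
    refine mem_range_of_characters (Tensor.map R S ω d₂).toAddMonoidHom fun ψ hψ => ?_
    let f : P.complex.X (i + 1) ⟶ ModuleCat.of S (CharDual S ω) :=
      ModuleCat.ofHom (Tensor.curry R S ω ψ)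
    have hf : P.complex.d (i + 2) (i + 1) ≫ f = 0 := by
      refine ModuleCat.hom_ext (LinearMap.ext fun p => ?_)
      change (Tensor.curry R S ω ψ (d₂ p) : CharDual S ω) = 0
      exact CharDual.ext fun x => hψ (tmul R S ω x p)
    obtain ⟨g, hg⟩ := (P.extMk_eq_zero_iff f (i + 2) rfl hf i rfl).1 (h.elim _ _)
    obtain ⟨c, hc⟩ := (Tensor.curry_bijective R S ω).2 g.hom
    have key : ∀ t, ψ t = c (Tensor.map R S ω d₁ t) := by
      intro t
      induction t using Tensor.induction with
      | tmul x p =>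
        rw [Tensor.map_tmul, ← Tensor.curry_apply, ← Tensor.curry_apply, hc]
        exact (congrArg (fun k => (show CharDual S ω from k.hom p) x) hg).symm
      | add a b ha hb => rw [map_add, map_add, map_add, ha, hb]
    rw [key, ht, map_zero]

end TensorDuality

/-! ### The transpose of the evaluation map. -/

section Evaluation

variable (R S : Type u) [Ring R] [Ring S]
variable (ω : Type u) [AddCommGroup ω] [Module R ω] [Module Sᵐᵒᵖ ω] [SMulCommClass R Sᵐᵒᵖ ω]

/-- The transpose `M⁺ → Hom_S(M_*, ω⁺)` of the evaluation map `θ_M`. -/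
noncomputable def thetaDual (M : Type u) [AddCommGroup M] [Module R M] (φ : CharacterModule M) :
    HomStar R ω M →ₗ[S] CharDual S ω :=
  Tensor.curry R S ω (CharacterModule.dual ((theta R S ω M).restrictScalars ℤ) φ)

/-- `thetaDual` is the character dual of `θ_M` followed by the bijection `Tensor.curry`, and
dualizing into `ℚ/ℤ` preserves and reflects bijectivity. -/
theorem thetaDual_bijective_iff (M : Type u) [AddCommGroup M] [Module R M] :
    Function.Bijective (thetaDual R S ω M) ↔ Function.Bijective (theta R S ω M) := by
  have h := CharacterModule.dual_bijective_iff_bijective (f := (theta R S ω M).restrictScalars ℤ)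
  exact (Function.Bijective.of_comp_iff' (Tensor.curry_bijective R S ω) _).trans h

end Evaluation

/-! ### Character modules of projectives. -/

section InjectiveCharDual

variable (S : Type u) [Ring S] (W : Type u) [AddCommGroup W] [Module Sᵐᵒᵖ W]

/-- The character module of a projective right module is injective. -/
theorem injective_charDual_of_projective [Module.Projective Sᵐᵒᵖ W] :
    Module.Injective S (CharDual S W) := by
  obtain ⟨σ, hσ⟩ := Module.projective_def.1 (inferInstance : Module.Projective Sᵐᵒᵖ W)
  refine ⟨fun N N' _ _ _ _ ι hι b => ?_⟩
  -- Every `v : W` serves as a basis vector of the free module `W →₀ Sᵐᵒᵖ`, so these extensions need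
  -- no compatibility with one another. The section `σ` then assembles them into one `S`-linear map.
  choose γ hγ using fun v : W => exists_character_extension ι.toAddMonoidHom
    (show CharacterModule N from AddMonoidHom.mk' (fun n => b n v) fun n m => by
      rw [map_add, CharDual.add_apply])
    fun n hn => by
      have : n = 0 := hι (hn.trans (map_zero ι).symm)
      rw [this]
      exact map_zero _
  let d : N' → W →+ AddCircle (1 : ℚ) := fun n' =>
    (Finsupp.liftAddHom fun v => AddMonoidHom.mk' (fun s : Sᵐᵒᵖ => γ v (s.unop • n'))
      fun s t => by rw [MulOpposite.unop_add, add_smul, map_add]).comp σ.toAddMonoidHom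
  have hd : ∀ n' w, d n' w = (σ w).sum fun v s => γ v (s.unop • n') := fun _ _ => rfl
  refine ⟨{ toFun := d, map_add' := ?_, map_smul' := ?_ }, ?_⟩
  · intro n m
    refine DFunLike.ext _ _ fun w => ?_
    refine (hd _ _).trans (Eq.trans ?_ (congrArg₂ (· + ·) (hd n w) (hd m w)).symm)
    rw [← Finsupp.sum_add]
    exact Finsupp.sum_congr fun v _ => by rw [smul_add, map_add]
  · intro t n
    refine DFunLike.ext _ _ fun w => ?_
    refine (hd _ _).trans (Eq.trans ?_ (hd n (MulOpposite.op t • w)).symm)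
    rw [map_smul, Finsupp.sum_smul_index fun v => by
      rw [MulOpposite.unop_zero, zero_smul, map_zero]]
    exact Finsupp.sum_congr fun v _ => by
      rw [MulOpposite.unop_mul, MulOpposite.unop_op, mul_smul]
  · intro n
    refine CharDual.ext fun w => ?_
    refine (hd _ _).trans ?_
    have h1 : ∀ v (s : Sᵐᵒᵖ), γ v (s.unop • ι n) = b n (s • v) := fun v s => by
      rw [← map_smul]
      refine (hγ v (s.unop • n)).trans ?_
      exact DFunLike.congr_fun (b.map_smul s.unop n) v
    simp_rw [h1]
    conv_rhs => rw [← hσ w, Finsupp.linearCombination_apply, map_finsuppSum]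
    rfl

end InjectiveCharDual

/-! ### Hom evaluation: `Hom_R(ω, I)` for injective `I`. -/

section Pairing

variable (R S : Type u) [Ring R] [Ring S]
variable (ω : Type u) [AddCommGroup ω] [Module R ω] [Module Sᵐᵒᵖ ω] [SMulCommClass R Sᵐᵒᵖ ω]
  [SMulCommClass Sᵐᵒᵖ R ω]
variable {V W : Type u} [AddCommGroup V] [Module Sᵐᵒᵖ V] [AddCommGroup W] [Module Sᵐᵒᵖ W]
variable (I : Type u) [AddCommGroup I] [Module R I]

/-- Evaluation at `w` as an `R`-linear map `Hom_{Sᵒᵖ}(W, ω) → ω`. -/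
def evalAt (w : W) : (W →ₗ[Sᵐᵒᵖ] ω) →ₗ[R] ω where
  toFun g := g w
  map_add' _ _ := rfl
  map_smul' _ _ := rfl

/-- The transpose `Hom_{Sᵒᵖ}(W, ω) → Hom_{Sᵒᵖ}(V, ω)` of `f : V → W`. -/
def homPrecomp (f : V →ₗ[Sᵐᵒᵖ] W) : (W →ₗ[Sᵐᵒᵖ] ω) →ₗ[R] (V →ₗ[Sᵐᵒᵖ] ω) where
  toFun g := g ∘ₗ f
  map_add' _ _ := rfl
  map_smul' _ _ := rfl

/-- The double transpose
`Hom_R(Hom_{Sᵒᵖ}(V, ω), I) → Hom_R(Hom_{Sᵒᵖ}(W, ω), I)` of `f : V → W`. -/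
def homPrecomp₂ (f : V →ₗ[Sᵐᵒᵖ] W) :
    ((V →ₗ[Sᵐᵒᵖ] ω) →ₗ[R] I) →+ ((W →ₗ[Sᵐᵒᵖ] ω) →ₗ[R] I) where
  toFun h := h ∘ₗ homPrecomp R S ω f
  map_zero' := rfl
  map_add' _ _ := rfl

/-- The character dual of the natural map
`W ⊗_S Hom_R(ω, I) → Hom_R(Hom_{Sᵒᵖ}(W, ω), I)`, `w ⊗ f ↦ (g ↦ f (g w))`. -/
def pairing (W : Type u) [AddCommGroup W] [Module Sᵐᵒᵖ W]
    (l : CharacterModule ((W →ₗ[Sᵐᵒᵖ] ω) →ₗ[R] I)) : HomStar R ω I →ₗ[S] CharDual S W where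
  toFun f := AddMonoidHom.mk'
    (fun w => l (LinearMap.comp (show ω →ₗ[R] I from f) (evalAt R S ω w))) fun v w => by
      rw [← map_add]
      congr 1
      ext g
      exact (congrArg f (g.map_add v w)).trans (LinearMap.map_add (show ω →ₗ[R] I from f) _ _)
  map_add' f f' := CharDual.ext fun w => map_add l
    (LinearMap.comp (show ω →ₗ[R] I from f) (evalAt R S ω w))
    (LinearMap.comp (show ω →ₗ[R] I from f') (evalAt R S ω w))
  map_smul' s f := CharDual.ext fun w => congrArg l (LinearMap.ext fun g =>
    congrArg f (g.map_smul (MulOpposite.op s) w).symm)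

theorem pairing_comp (f : V →ₗ[Sᵐᵒᵖ] W) (l : CharacterModule ((W →ₗ[Sᵐᵒᵖ] ω) →ₗ[R] I)) :
    pairing R S ω I V (show CharacterModule _ from AddMonoidHom.comp l (homPrecomp₂ R S ω I f)) =
      CharDual.map f ∘ₗ pairing R S ω I W l := rfl

/-- A finite dual basis `(e i, q i)` of `W` writes each `h` as the finite sum of the images of `e i
⊗ (h ∘ a i)`, so a character is determined by its values on pure tensors and can be prescribed
there. -/
theorem pairing_bijective_of_projective [Module.Finite Sᵐᵒᵖ W] [Module.Projective Sᵐᵒᵖ W] :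
    Function.Bijective (pairing R S ω I W) := by
  obtain ⟨n, p, q, -, -, hpq⟩ := Module.Finite.exists_comp_eq_id_of_projective Sᵐᵒᵖ W
  let e : Fin n → W := fun i => p (Pi.single i 1)
  have hsum : ∀ w, ∑ i, q w i • e i = w := fun w => by
    conv_rhs => rw [← LinearMap.id_apply (R := Sᵐᵒᵖ) w, ← hpq, LinearMap.comp_apply,
      ← Finset.univ_sum_single (q w), map_sum]
    refine Finset.sum_congr rfl fun i _ => ?_
    rw [← map_smul, ← Pi.single_smul', smul_eq_mul, mul_one]
  let a : Fin n → ω →ₗ[R] (W →ₗ[Sᵐᵒᵖ] ω) := fun i =>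
    { toFun := fun y => LinearMap.toSpanSingleton Sᵐᵒᵖ ω y ∘ₗ LinearMap.proj i ∘ₗ q
      map_add' := fun x y => LinearMap.ext fun w => smul_add (q w i) x y
      map_smul' := fun r y => LinearMap.ext fun w => smul_comm (q w i) r y }
  have ha : ∀ i y w, a i y w = q w i • y := fun _ _ _ => rfl
  have hdecomp : ∀ h : (W →ₗ[Sᵐᵒᵖ] ω) →ₗ[R] I,
      ∑ i, (h ∘ₗ a i) ∘ₗ evalAt R S ω (e i) = h := fun h => by
    ext g
    rw [LinearMap.sum_apply]
    change ∑ i, h (a i (g (e i))) = h g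
    rw [← map_sum]
    congr 1
    ext w
    rw [LinearMap.sum_apply]
    conv_rhs => rw [← hsum w, map_sum]
    exact Finset.sum_congr rfl fun i _ => (g.map_smul _ _).symm
  constructor
  · intro l l' h
    refine DFunLike.ext _ _ fun k => ?_
    rw [← hdecomp k, map_sum, map_sum]
    exact Finset.sum_congr rfl fun i _ => DFunLike.congr_fun
      (LinearMap.congr_fun h (show HomStar R ω I from k ∘ₗ a i)) (e i)
  · intro b
    let l : ((W →ₗ[Sᵐᵒᵖ] ω) →ₗ[R] I) →+ AddCircle (1 : ℚ) :=
      AddMonoidHom.mk' (fun h => ∑ i, b (show HomStar R ω I from h ∘ₗ a i) (e i)) fun h h' => by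
        rw [← Finset.sum_add_distrib]
        refine Finset.sum_congr rfl fun i _ => ?_
        exact DFunLike.congr_fun
          (b.map_add (show HomStar R ω I from h ∘ₗ a i) (show HomStar R ω I from h' ∘ₗ a i)) (e i)
    refine ⟨l, LinearMap.ext fun f => CharDual.ext fun w => ?_⟩
    change ∑ i, b (show HomStar R ω I from
      (LinearMap.comp (show ω →ₗ[R] I from f) (evalAt R S ω w)) ∘ₗ a i) (e i) = b f w
    have h1 : ∀ i, b (show HomStar R ω I from
      (LinearMap.comp (show ω →ₗ[R] I from f) (evalAt R S ω w)) ∘ₗ a i) (e i) =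
        b f (q w i • e i) := fun i =>
      DFunLike.congr_fun (b.map_smul (MulOpposite.unop (q w i)) f) (e i)
    simp_rw [h1]
    rw [← map_sum, hsum]

variable [Module.Injective R I]

theorem homPrecomp₂_surjective {f : V →ₗ[Sᵐᵒᵖ] W} (hf : Function.Surjective f) :
    Function.Surjective (homPrecomp₂ R S ω I f) := fun h => by
  refine exists_injective_extension (homPrecomp R S ω f) h fun g hg => ?_
  have : g = 0 := LinearMap.ext fun w => by
    obtain ⟨v, rfl⟩ := hf w
    exact LinearMap.congr_fun (LinearMap.mem_ker.1 hg) v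
  rw [this]
  exact zero_mem _

/-- Reduction to a finite free cover of `W`, along which the double transpose stays surjective
because `I` is injective. -/
theorem pairing_injective_of_finite [Module.Finite Sᵐᵒᵖ W] :
    Function.Injective (pairing R S ω I W) := by
  obtain ⟨n, p, hp⟩ := Module.Finite.exists_fin' Sᵐᵒᵖ W
  let F : Type u := ULift.{u} (Fin n) → Sᵐᵒᵖ
  let e : F ≃ₗ[Sᵐᵒᵖ] (Fin n → Sᵐᵒᵖ) := LinearEquiv.funCongrLeft Sᵐᵒᵖ Sᵐᵒᵖ Equiv.ulift.symm
  let π : F →ₗ[Sᵐᵒᵖ] W := p ∘ₗ e.toLinearMap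
  have hπ : Function.Surjective π := hp.comp e.surjective
  intro l l' h
  have h1 : (show CharacterModule _ from AddMonoidHom.comp l (homPrecomp₂ R S ω I π)) =
      (show CharacterModule _ from AddMonoidHom.comp l' (homPrecomp₂ R S ω I π)) :=
    (pairing_bijective_of_projective R S ω I).1 (by rw [pairing_comp, pairing_comp, h])
  refine DFunLike.ext _ _ fun k => ?_
  obtain ⟨k, rfl⟩ := homPrecomp₂_surjective R S ω I hπ k
  exact DFunLike.congr_fun h1 k

/-- Half of a five lemma on `K → P → W → 0`: bijectivity at the projective `P` and injectivity at
the finitely generated `K`. -/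
theorem pairing_surjective_of_isFP (hW : IsFP 1 Sᵐᵒᵖ W) :
    Function.Surjective (pairing R S ω I W) := by
  obtain ⟨P, K, f, g, hf, hg, hfg, hP, hPfin, hK⟩ := hW
  have : Module.Finite Sᵐᵒᵖ K := hK
  intro b
  obtain ⟨l, hl⟩ := (pairing_bijective_of_projective R S ω I (W := P)).2 (CharDual.map g ∘ₗ b)
  have hlf : (show CharacterModule _ from AddMonoidHom.comp l (homPrecomp₂ R S ω I f)) = 0 := by
    refine pairing_injective_of_finite R S ω I ?_
    rw [pairing_comp, hl]
    refine LinearMap.ext fun x => CharDual.ext fun k => ?_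
    exact (congrArg (b x) (hfg.apply_apply_eq_zero k)).trans (map_zero (b x))
  -- `l` descends along `homPrecomp₂ g`: an `h` killed by it vanishes on the maps `P → ω` that kill
  -- `K`, hence comes from `Hom_{Sᵒᵖ}(K, ω)` as `I` is injective, and there `l` is zero by `hlf`.
  obtain ⟨l', hl'⟩ := exists_character_extension (homPrecomp₂ R S ω I g) l fun h hh => by
    obtain ⟨h', rfl⟩ := exists_injective_extension (homPrecomp R S ω f) h fun k hk => by
      have hk' : ∀ x, k (f x) = 0 := fun x => LinearMap.congr_fun (LinearMap.mem_ker.1 hk) x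
      let e := g.quotKerEquivOfSurjective hg
      have hker : LinearMap.ker g ≤ LinearMap.ker k := fun x hx => by
        obtain ⟨y, rfl⟩ := (hfg x).1 hx
        exact hk' y
      let k' : W →ₗ[Sᵐᵒᵖ] ω := (LinearMap.ker g).liftQ k hker ∘ₗ e.symm.toLinearMap
      have hk'' : k = homPrecomp R S ω g k' := by
        ext x
        change k x = (LinearMap.ker g).liftQ k hker (e.symm (g x))
        have : e.symm (g x) = Submodule.Quotient.mk x := e.symm_apply_eq.2 rfl
        rw [this]
        rfl
      rw [hk'']
      exact LinearMap.congr_fun hh k'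
    exact DFunLike.congr_fun hlf h'
  refine ⟨l', LinearMap.ext fun x => CharDual.map_injective hg ?_⟩
  have h2 : (show CharacterModule _ from AddMonoidHom.comp l' (homPrecomp₂ R S ω I g)) = l :=
    DFunLike.ext _ _ hl'
  have h3 := pairing_comp R S ω I g l'
  rw [h2, hl] at h3
  exact (LinearMap.congr_fun h3 x).symm

/-- The evaluation map is bijective on injective modules. -/
theorem thetaDual_bijective_of_injective (hfp : IsFP 1 Sᵐᵒᵖ ω)
    (hR : Function.Bijective (leftMul R S ω)) : Function.Bijective (thetaDual R S ω I) := by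
  have := hfp.finite
  let E : R →ₗ[R] (ω →ₗ[Sᵐᵒᵖ] ω) :=
    { toFun := leftMul R S ω
      map_add' := fun r s => LinearMap.ext fun x => add_smul r s x
      map_smul' := fun r s => LinearMap.ext fun x => mul_smul r s x }
  let e : R ≃ₗ[R] (ω →ₗ[Sᵐᵒᵖ] ω) := LinearEquiv.ofBijective E hR
  have he1 : e 1 = LinearMap.id := LinearMap.ext fun x => one_smul R x
  have hes : e.symm LinearMap.id = 1 := e.symm_apply_eq.2 he1.symm
  let ev : ((ω →ₗ[Sᵐᵒᵖ] ω) →ₗ[R] I) →ₗ[ℤ] I :=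
    { toFun := fun h => h LinearMap.id
      map_add' := fun _ _ => rfl
      map_smul' := fun _ _ => rfl }
  have hev : Function.Bijective ev := by
    constructor
    · intro h h' hh
      refine LinearMap.ext fun g => ?_
      obtain ⟨r, rfl⟩ := e.surjective g
      have hr : e r = r • LinearMap.id := by rw [← he1, ← map_smul, smul_eq_mul, mul_one]
      rw [hr, map_smul, map_smul]
      exact congrArg (r • ·) hh
    · intro x
      refine ⟨LinearMap.toSpanSingleton R I x ∘ₗ e.symm.toLinearMap, ?_⟩
      change e.symm LinearMap.id • x = x
      rw [hes, one_smul]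
  have hp : Function.Bijective (pairing R S ω I ω) :=
    ⟨pairing_injective_of_finite R S ω I, pairing_surjective_of_isFP R S ω I hfp⟩
  -- By definition `thetaDual` is the dual of `ev` followed by the pairing at `W = ω`; the homothety
  -- `R ≅ Hom_{Sᵒᵖ}(ω, ω)` makes `ev` bijective.
  exact hp.comp (CharacterModule.dual_bijective_iff_bijective.2 hev)

/-- Dual form of `Tor_i(W, Hom_R(ω, I)) ≅ Hom_R(Ext^i(W, ω), I)`. The induction shifts along `0 → W⁺
→ P⁺ → K⁺ → 0`, where `P⁺` is injective. -/
theorem extVanishes_homStar_of_injective (i : ℕ) (hW : IsFP (i + 2) Sᵐᵒᵖ W)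
    (hext : ∀ j, ExtVanishes Sᵐᵒᵖ W ω (j + 1)) :
    ExtVanishes S (HomStar R ω I) (CharDual S W) (i + 1) := by
  induction i generalizing W with
  | zero =>
    obtain ⟨P, K, f, g, hf, hg, hfg, hP, -, hK⟩ := hW
    have := injective_charDual_of_projective S P
    refine ExtVanishes.one_of_lift (CharDual.map_injective hg) (CharDual.map_surjective hf)
      (CharDual.map_exact hfg) (ExtVanishes.of_injective 0) fun b => ?_
    obtain ⟨l, rfl⟩ := pairing_surjective_of_isFP R S ω I hK b
    -- `Ext¹(W, ω) = 0` makes restriction `Hom(P, ω) → Hom(K, ω)` surjective, so its transpose into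
    -- `I` is injective and `l` extends along it.
    obtain ⟨l', hl'⟩ := exists_character_extension (homPrecomp₂ R S ω I f) l fun h hh => by
      have : h = 0 := LinearMap.ext fun k => by
        obtain ⟨k, rfl⟩ := ExtVanishes.exists_extension hf hg hfg (hext 0) k
        exact LinearMap.congr_fun hh k
      rw [this, map_zero]
    refine ⟨pairing R S ω I P l', ?_⟩
    rw [← pairing_comp]
    congr 1
    exact DFunLike.ext _ _ hl'
  | succ i ih =>
    obtain ⟨P, K, f, g, hf, hg, hfg, hP, -, hK⟩ := hW
    have := injective_charDual_of_projective S P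
    exact ExtVanishes.right_first (CharDual.map_injective hg) (CharDual.map_surjective hf)
      (CharDual.map_exact hfg)
      (ih hK fun j => ExtVanishes.left_first hf hg hfg (ExtVanishes.of_projective j) (hext (j + 1)))
      (ExtVanishes.of_injective (i + 1))

end Pairing

/-! ### Free presentations, injective dimension of `W⁺`, and Ext into direct sums. -/

section FreePresentation

variable (A : Type u) [Ring A] (W : Type u) [AddCommGroup W] [Module A W]

theorem exists_freePresentation : ∃ (K : ModuleCat.{u} A) (f : K →ₗ[A] ModuleCat.of A (W →₀ A))
    (g : ModuleCat.of A (W →₀ A) →ₗ[A] W),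
    Function.Injective f ∧ Function.Surjective g ∧ Function.Exact f g := by
  let g : ModuleCat.of A (W →₀ A) →ₗ[A] W := Finsupp.linearCombination A (id : W → W)
  refine ⟨ModuleCat.of A (LinearMap.ker g), (LinearMap.ker g).subtype, g,
    Subtype.val_injective, Finsupp.linearCombination_id_surjective A W, ?_⟩
  rw [LinearMap.exact_iff, Submodule.range_subtype]

instance : Module.Projective A (ModuleCat.of A (W →₀ A)) :=
  inferInstanceAs (Module.Projective A (W →₀ A))

end FreePresentation

section FiniteDimension

variable (S : Type u) [Ring S] {W : Type u} [AddCommGroup W] [Module Sᵐᵒᵖ W]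

/-- Passing to the character module turns projective dimension into injective dimension. -/
theorem extVanishes_charDual (n : ℕ)
    (h : HasProjectiveDimensionLT (ModuleCat.of Sᵐᵒᵖ W) (n + 1)) {N : Type u} [AddCommGroup N]
    [Module S N] (i : ℕ) (hi : n + 1 ≤ i) : ExtVanishes S N (CharDual S W) i := by
  induction n generalizing W i with
  | zero =>
    have : Module.Projective Sᵐᵒᵖ W := (IsProjective.iff_projective W).2
      (projective_iff_hasProjectiveDimensionLT_one.2 h)
    have := injective_charDual_of_projective S W
    obtain ⟨j, rfl⟩ := Nat.exists_eq_add_of_le' hi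
    exact ExtVanishes.of_injective j
  | succ n ih =>
    obtain ⟨K, f, g, hf, hg, hfg⟩ := exists_freePresentation Sᵐᵒᵖ W
    have := injective_charDual_of_projective S (ModuleCat.of Sᵐᵒᵖ (W →₀ Sᵐᵒᵖ))
    obtain ⟨w, hS⟩ := exists_shortExact hf hg hfg
    have hK : HasProjectiveDimensionLT (ModuleCat.of Sᵐᵒᵖ K) (n + 1) :=
      (hS.hasProjectiveDimensionLT_X₃_iff n ((IsProjective.iff_projective _).1 inferInstance)).1 h
    obtain ⟨j, rfl⟩ := Nat.exists_eq_add_of_le' hi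
    exact ExtVanishes.right_first (CharDual.map_injective hg) (CharDual.map_surjective hf)
      (CharDual.map_exact hfg) (ih hK (j + n + 1) (by lia)) (ExtVanishes.of_injective (j + n + 1))

end FiniteDimension

section DirectSum

variable {A : Type u} [Ring A] {W Y : Type u} [AddCommGroup W] [Module A W] [AddCommGroup Y]
  [Module A Y]

theorem extVanishes_finsupp (X : Type u) (i : ℕ) (hW : IsFP (i + 1) A W)
    (h : ∀ j, ExtVanishes A W Y (j + 1)) : ExtVanishes A W (X →₀ Y) (i + 1) := by
  induction i generalizing W with
  | zero =>
    obtain ⟨P, K, f, g, hf, hg, hfg, hP, -, hK⟩ := hW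
    have : Module.Finite A K := hK
    refine ExtVanishes.one_of_extension hf hg hfg (ExtVanishes.of_projective 0) fun b => ?_
    classical
    obtain ⟨G, hG⟩ := (inferInstance : Module.Finite A K).fg_top
    -- As `K` is finitely generated, `b` lands in finitely many summands, so the coordinatewise
    -- extensions chosen below have a finite sum.
    let s : Finset X := G.biUnion fun k => (b k).support
    have hs : ∀ k, b k ∈ Finsupp.supported Y A (s : Set X) := by
      have : (⊤ : Submodule A K) ≤ (Finsupp.supported Y A (s : Set X)).comap b := by
        rw [← hG, Submodule.span_le]
        intro k hk
        exact (Finsupp.mem_supported A _).2 (Finset.coe_subset.2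
          (Finset.subset_biUnion_of_mem (fun k => (b k).support) hk))
      exact fun k => this trivial
    choose e he using fun x : X =>
      ExtVanishes.exists_extension hf hg hfg (h 0)
      ((Finsupp.lapply x : (X →₀ Y) →ₗ[A] Y) ∘ₗ b)
    refine ⟨∑ x ∈ s, (Finsupp.lsingle x : Y →ₗ[A] X →₀ Y) ∘ₗ e x, LinearMap.ext fun k => ?_⟩
    have he' : ∀ x, e x (f k) = b k x := fun x => LinearMap.congr_fun (he x) k
    rw [LinearMap.comp_apply, LinearMap.sum_apply]
    simp only [LinearMap.comp_apply, he', Finsupp.lsingle_apply]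
    exact (Finsupp.sum_of_support_subset _ (Finset.coe_subset.1
      ((Finsupp.mem_supported A _).1 (hs k))) Finsupp.single (by simp)).symm.trans
      (Finsupp.sum_single _)
  | succ i ih =>
    obtain ⟨P, K, f, g, hf, hg, hfg, hP, -, hK⟩ := hW
    exact ExtVanishes.left_third hf hg hfg (ih hK fun j =>
      ExtVanishes.left_first hf hg hfg (ExtVanishes.of_projective j) (h (j + 1)))
      (ExtVanishes.of_projective (i + 1))

end DirectSum

/-! ### Exactness of `ω ⊗_S -` and the Ext groups `Ext_R(ω, ω ⊗_S N)`. -/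

section TensorExact

variable (R S : Type u) [Ring R] [Ring S]
variable (ω : Type u) [AddCommGroup ω] [Module R ω] [Module Sᵐᵒᵖ ω] [SMulCommClass R Sᵐᵒᵖ ω]

/-- `ω ⊗_S S^(X)` is the direct sum of copies of `ω`. -/
theorem nonempty_tensor_finsupp_equiv (X : Type u) :
    Nonempty ((X →₀ ω) ≃ₗ[R] Tensor R S ω (X →₀ S)) := by
  let a : (X →₀ ω) →ₗ[R] Tensor R S ω (X →₀ S) := Finsupp.lsum ℤ fun x =>
    { toFun := fun w => tmul R S ω w (Finsupp.single x 1)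
      map_add' := fun v w => tmul_add_left R S ω v w _
      map_smul' := fun r w => (smul_tmul R S ω r w _).symm }
  have ha : ∀ x w, a (Finsupp.single x w) = tmul R S ω w (Finsupp.single x 1) := fun x w => by
    simp only [a, Finsupp.lsum_single]
    rfl
  let β : ω →ₗ[R] (X →₀ S) →ₗ[ℤ] (X →₀ ω) :=
    { toFun := fun w => (Finsupp.mapRange.addMonoidHom (AddMonoidHom.mk'
        (fun s : S => MulOpposite.op s • w) fun s t => by
          rw [MulOpposite.op_add, add_smul])).toIntLinearMap
      map_add' := fun v w => by ext; simp
      map_smul' := fun r w => LinearMap.ext fun f => Finsupp.ext fun x =>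
        (smul_comm r (MulOpposite.op (f x)) w).symm }
  let b : Tensor R S ω (X →₀ S) →ₗ[R] (X →₀ ω) := (tensorRel R S ω (X →₀ S)).liftQ
    (TensorProduct.AlgebraTensorModule.lift β) (by
      rw [tensorRel, Submodule.span_le]
      rintro _ ⟨w, s, f, rfl⟩
      refine LinearMap.mem_ker.2 ((map_sub _ _ _).trans (sub_eq_zero.2 ?_))
      refine Finsupp.ext fun x => ?_
      change MulOpposite.op (f x) • MulOpposite.op s • w = MulOpposite.op (s * f x) • w
      rw [MulOpposite.op_mul, mul_smul])
  have hb : ∀ w f x, b (tmul R S ω w f) x = MulOpposite.op (f x) • w := fun _ _ _ => rfl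
  refine ⟨LinearEquiv.ofLinearMap a b ?_ ?_⟩
  · refine Tensor.hom_ext R S ω fun w f => ?_
    induction f using Finsupp.induction_linear with
    | zero =>
      have h0 : tmul R S ω w (0 : X →₀ S) = 0 := by simp [tmul]
      rw [h0, map_zero, map_zero]
    | add f g hf hg => rw [tmul_add, map_add, map_add, hf, hg]
    | single x s =>
      have h1 : b (tmul R S ω w (Finsupp.single x s)) =
          Finsupp.single x (MulOpposite.op s • w) := by
        refine Finsupp.ext fun y => ?_
        rw [hb]
        by_cases h : x = y
        · subst h; simp
        · simp [h]
      rw [LinearMap.comp_apply, h1, ha, ← tmul_smul, Finsupp.smul_single, smul_eq_mul, mul_one]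
      rfl
  · refine Finsupp.lhom_ext fun x w => ?_
    rw [LinearMap.comp_apply, ha]
    refine Finsupp.ext fun y => ?_
    rw [hb]
    by_cases h : x = y
    · subst h; simp
    · simp [h]

variable {K P N : Type u} [AddCommGroup K] [Module S K] [AddCommGroup P] [Module S P]
  [AddCommGroup N] [Module S N] {f : K →ₗ[S] P} {g : P →ₗ[S] N}

theorem Tensor.map_surjective (hg : Function.Surjective g) :
    Function.Surjective (Tensor.map R S ω g) := fun t => by
  induction t using Tensor.induction with
  | tmul x n =>
    obtain ⟨p, rfl⟩ := hg n
    exact ⟨tmul R S ω x p, rfl⟩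
  | add a b ha hb =>
    obtain ⟨a, rfl⟩ := ha
    obtain ⟨b, rfl⟩ := hb
    exact ⟨a + b, map_add _ _ _⟩

/-- Right exactness read off from characters: one that kills the image of `ω ⊗ f` is a map `P → ω⁺`
vanishing on `ker g`, so it descends to `N`. -/
theorem Tensor.map_exact (hg : Function.Surjective g) (hfg : Function.Exact f g) :
    Function.Exact (Tensor.map R S ω f) (Tensor.map R S ω g) := by
  intro t
  constructor
  · intro ht
    refine mem_range_of_characters (Tensor.map R S ω f).toAddMonoidHom fun ψ hψ => ?_
    have hker : LinearMap.ker g ≤ LinearMap.ker (Tensor.curry R S ω ψ) := fun p hp => by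
      obtain ⟨k, rfl⟩ := (hfg p).1 hp
      exact CharDual.ext fun x => hψ (tmul R S ω x k)
    let c : N →ₗ[S] CharDual S ω := (LinearMap.ker g).liftQ _ hker ∘ₗ
      (g.quotKerEquivOfSurjective hg).symm.toLinearMap
    have hc : ∀ p, c (g p) = Tensor.curry R S ω ψ p := fun p => by
      have : (g.quotKerEquivOfSurjective hg).symm (g p) = Submodule.Quotient.mk p :=
        (LinearEquiv.symm_apply_eq _).2 rfl
      change (LinearMap.ker g).liftQ _ hker ((g.quotKerEquivOfSurjective hg).symm (g p)) = _
      rw [this]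
      rfl
    obtain ⟨φ, hφ⟩ := (Tensor.curry_bijective R S ω).2 c
    have key : ∀ t, ψ t = φ (Tensor.map R S ω g t) := fun t => by
      induction t using Tensor.induction with
      | tmul x p =>
        rw [Tensor.map_tmul, ← Tensor.curry_apply, ← Tensor.curry_apply, hφ, hc]
      | add a b ha hb => rw [map_add, map_add, map_add, ha, hb]
    rw [key, ht, map_zero]
  · rintro ⟨t, rfl⟩
    induction t using Tensor.induction with
    | tmul x k =>
      rw [Tensor.map_tmul, Tensor.map_tmul, hfg.apply_apply_eq_zero]
      simp [tmul]
    | add a b ha hb => rw [map_add, map_add, ha, hb, add_zero]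

/-- `Ext¹_S(N, ω⁺) = 0` lets every character of `ω ⊗_S K` factor through `ω ⊗_S P`, and characters
detect zero. -/
theorem Tensor.map_injective (hf : Function.Injective f) (hg : Function.Surjective g)
    (hfg : Function.Exact f g) (hN : ExtVanishes S N (CharDual S ω) 1) :
    Function.Injective (Tensor.map R S ω f) := by
  refine (injective_iff_map_eq_zero _).2 fun t ht => ?_
  refine CharacterModule.eq_zero_of_character_apply fun c => ?_
  obtain ⟨e, he⟩ := ExtVanishes.exists_extension hf hg hfg hN (Tensor.curry R S ω c)
  obtain ⟨d, hd⟩ := (Tensor.curry_bijective R S ω).2 e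
  have key : ∀ t, c t = d (Tensor.map R S ω f t) := fun t => by
    induction t using Tensor.induction with
    | tmul x k =>
      rw [Tensor.map_tmul, ← Tensor.curry_apply, ← Tensor.curry_apply, hd, ← he]
      rfl
    | add a b ha hb => rw [map_add, map_add, map_add, ha, hb]
  rw [key, ht, map_zero]

/-- If `_Rω` has finite projective dimension, then `ω ⊗_S N` lies in `_Rω^⊥` for every `N` that is
acyclic for `ω ⊗_S -`. -/
theorem extVanishes_tensor (hω : ∀ n, IsFP n R ω) (hext : ∀ j, ExtVanishes R ω ω (j + 1)) (n : ℕ)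
    (hn : HasProjectiveDimensionLT (ModuleCat.of R ω) n)
    (hN : ∀ j, ExtVanishes S N (CharDual S ω) (j + 1)) (i : ℕ) :
    ExtVanishes R ω (Tensor R S ω N) (i + 1) := by
  -- Induction on the distance `m` from degree `i + 1` up to `n`, where Ext vanishes for all
  -- modules. Each step replaces `N` by the kernel of a free cover, which is again acyclic, and
  -- raises the degree by one.
  have key : ∀ (m : ℕ) {N : Type u} [AddCommGroup N] [Module S N],
      (∀ j, ExtVanishes S N (CharDual S ω) (j + 1)) → ∀ i, n ≤ i + 1 + m →
      ExtVanishes R ω (Tensor R S ω N) (i + 1) := by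
    intro m
    induction m with
    | zero =>
      intro N _ _ _ i hi
      exact HasProjectiveDimensionLT.subsingleton _ n _ hi _
    | succ m ih =>
      intro N _ _ hN i hi
      obtain ⟨K, f, g, hf, hg, hfg⟩ := exists_freePresentation S N
      refine ExtVanishes.right_third (Tensor.map_injective R S ω hf hg hfg (hN 0))
        (Tensor.map_surjective R S ω hg) (Tensor.map_exact R S ω hg hfg) ?_
        (ih (fun j => ExtVanishes.left_first hf hg hfg (ExtVanishes.of_projective j) (hN (j + 1)))
          (i + 1) (by lia))
      exact (extVanishes_finsupp N i (hω _) hext).congr_right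
        (nonempty_tensor_finsupp_equiv R S ω N).some
  exact key n hN i (by lia)

end TensorExact

/-! ### Exactness of `Hom_R(ω, -)`. -/

section HomStarExact

variable (R S : Type u) [Ring R] [Ring S]
variable (ω : Type u) [AddCommGroup ω] [Module R ω] [Module Sᵐᵒᵖ ω] [SMulCommClass R Sᵐᵒᵖ ω]
variable {M N P : Type u} [AddCommGroup M] [Module R M] [AddCommGroup N] [Module R N]
  [AddCommGroup P] [Module R P] {f : M →ₗ[R] N} {g : N →ₗ[R] P}

theorem HomStar.map_injective (hf : Function.Injective f) :
    Function.Injective (HomStar.map R S ω f) := fun _ _ hk =>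
  DFunLike.ext _ _ fun x => hf (DFunLike.congr_fun hk x)

theorem HomStar.map_exact (hf : Function.Injective f) (hfg : Function.Exact f g) :
    Function.Exact (HomStar.map R S ω f) (HomStar.map R S ω g) := by
  intro h
  constructor
  · intro hh
    let e := LinearEquiv.ofInjective f hf
    let k : ω →ₗ[R] M := e.symm.toLinearMap ∘ₗ
      LinearMap.codRestrict (LinearMap.range f) (show ω →ₗ[R] N from h) fun x =>
        (hfg (h x)).1 (DFunLike.congr_fun hh x)
    refine ⟨k, DFunLike.ext _ _ fun x => ?_⟩
    exact congrArg Subtype.val (e.apply_symm_apply _)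
  · rintro ⟨k, rfl⟩
    exact DFunLike.ext _ _ fun x => hfg.apply_apply_eq_zero (k x)

theorem HomStar.map_surjective (hf : Function.Injective f) (hg : Function.Surjective g)
    (hfg : Function.Exact f g) (hM : ExtVanishes R ω M 1) :
    Function.Surjective (HomStar.map R S ω g) := fun h =>
  ExtVanishes.exists_lift hf hg hfg hM (show ω →ₗ[R] P from h)

end HomStarExact

/-! ### The cotranspose and the evaluation map. -/

section Cotorsionfree

variable (R S : Type u) [Ring R] [Ring S]
variable (ω : Type u) [AddCommGroup ω] [Module R ω] [Module Sᵐᵒᵖ ω] [SMulCommClass R Sᵐᵒᵖ ω]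

theorem thetaDual_comp {M N : Type u} [AddCommGroup M] [Module R M] [AddCommGroup N] [Module R N]
    (g : M →ₗ[R] N) (φ : CharacterModule N) :
    thetaDual R S ω M (show CharacterModule M from AddMonoidHom.comp φ g.toAddMonoidHom) =
      thetaDual R S ω N φ ∘ₗ HomStar.map R S ω g := rfl

/-- For an exact sequence `0 → M → E₀ → E₁` whose terms `E₀`, `E₁` lie in the Bass class up to the
condition `_Rω^⊥`, the cokernel of `(E₀)_* → (E₁)_*` is acyclic for `ω ⊗_S -` if and only if
`M_*` is and the evaluation map of `M` is bijective. -/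
theorem cokernel_acyclic_iff {M E₀ E₁ : Type u} [AddCommGroup M] [Module R M] [AddCommGroup E₀]
    [Module R E₀] [AddCommGroup E₁] [Module R E₁] {ι : M →ₗ[R] E₀} {d : E₀ →ₗ[R] E₁}
    (hι : Function.Injective ι) (hιd : Function.Exact ι d)
    (h₀ : ∀ j, ExtVanishes S (HomStar R ω E₀) (CharDual S ω) (j + 1))
    (h₁ : ∀ j, ExtVanishes S (HomStar R ω E₁) (CharDual S ω) (j + 1))
    (t₀ : Function.Bijective (thetaDual R S ω E₀))
    (t₁ : Function.Bijective (thetaDual R S ω E₁)) :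
    (∀ j, ExtVanishes S (HomStar R ω E₁ ⧸ LinearMap.range (HomStar.map R S ω d))
      (CharDual S ω) (j + 1)) ↔
    (∀ j, ExtVanishes S (HomStar R ω M) (CharDual S ω) (j + 1)) ∧
      Function.Bijective (thetaDual R S ω M) := by
  -- With `L` the range of `F`, the sequence splits into `0 → M_* → (E₀)_* → L → 0` and `0 → L →
  -- (E₁)_* → coker → 0`. Degrees above one are dimension shifting; the evaluation map governs
  -- degree one.
  let F := HomStar.map R S ω d
  have i₁ := HomStar.map_injective R S ω hι
  have s₁ : Function.Surjective F.rangeRestrict := LinearMap.surjective_rangeRestrict F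
  have e₁ : Function.Exact (HomStar.map R S ω ι) F.rangeRestrict := by
    rw [LinearMap.exact_iff, LinearMap.ker_rangeRestrict]
    exact LinearMap.exact_iff.1 (HomStar.map_exact R S ω hι hιd)
  have i₂ : Function.Injective (LinearMap.range F).subtype := Subtype.val_injective
  have s₂ : Function.Surjective (LinearMap.range F).mkQ := Submodule.mkQ_surjective _
  have e₂ : Function.Exact (LinearMap.range F).subtype (LinearMap.range F).mkQ := by
    rw [LinearMap.exact_iff, Submodule.ker_mkQ, Submodule.range_subtype]
  have hιφ : ∀ φ : CharacterModule M, ∃ ψ : CharacterModule E₀, ∀ m, ψ (ι m) = φ m := fun φ =>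
    exists_character_extension ι.toAddMonoidHom φ fun m hm => by
      rw [hι (hm.trans (map_zero ι).symm), map_zero]
  constructor
  · intro h
    have hL : ∀ j, ExtVanishes S (LinearMap.range F) (CharDual S ω) (j + 1) := fun j =>
      ExtVanishes.left_first i₂ s₂ e₂ (h₁ j) (h (j + 1))
    refine ⟨fun j => ExtVanishes.left_first i₁ s₁ e₁ (h₀ j) (hL (j + 1)), ?_, ?_⟩
    -- Extend `φ` to `ψ` on `E₀`. Its transpose kills `M_*`, so it factors through `L`, extends to
    -- `(E₁)_*` and comes from a character `χ` of `E₁`. Thus `ψ = χ ∘ d`, which is zero on `M`.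
    · have key : ∀ φ, thetaDual R S ω M φ = 0 → φ = 0 := by
        intro φ hφ
        obtain ⟨ψ, hψ⟩ := hιφ φ
        have hψ' : thetaDual R S ω E₀ ψ ∘ₗ HomStar.map R S ω ι = 0 := by
          rw [← thetaDual_comp, ← hφ]
          congr 1
          exact DFunLike.ext _ _ hψ
        have hker : LinearMap.ker F ≤ LinearMap.ker (thetaDual R S ω E₀ ψ) := fun x hx => by
          obtain ⟨y, rfl⟩ := (HomStar.map_exact R S ω hι hιd x).1 hx
          exact LinearMap.congr_fun hψ' y
        let l : LinearMap.range F →ₗ[S] CharDual S ω :=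
          (LinearMap.ker F).liftQ _ hker ∘ₗ F.quotKerEquivRange.symm.toLinearMap
        have hl : ∀ x, l (F.rangeRestrict x) = thetaDual R S ω E₀ ψ x := fun x => by
          have : F.quotKerEquivRange.symm (F.rangeRestrict x) = Submodule.Quotient.mk x :=
            (LinearEquiv.symm_apply_eq _).2 rfl
          change (LinearMap.ker F).liftQ _ hker (F.quotKerEquivRange.symm (F.rangeRestrict x)) = _
          rw [this]
          rfl
        obtain ⟨l', hl'⟩ := ExtVanishes.exists_extension i₂ s₂ e₂ (h 0) l
        obtain ⟨χ, rfl⟩ := t₁.2 l'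
        have h2 : (show CharacterModule E₀ from AddMonoidHom.comp χ d.toAddMonoidHom) = ψ := by
          refine t₀.1 (LinearMap.ext fun x => ?_)
          rw [thetaDual_comp, ← hl, ← hl']
          rfl
        refine DFunLike.ext _ _ fun m => ?_
        rw [← hψ, ← h2]
        exact (congrArg χ (hιd.apply_apply_eq_zero m)).trans (map_zero χ)
      intro φ φ' hφ
      rw [← sub_eq_zero]
      refine key _ ?_
      refine LinearMap.ext fun f => CharDual.ext fun x => ?_
      have h3 : φ (f x) = φ' (f x) := DFunLike.congr_fun (LinearMap.congr_fun hφ f) x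
      exact sub_eq_zero.2 h3
    · intro b
      obtain ⟨b', rfl⟩ := ExtVanishes.exists_extension i₁ s₁ e₁ (hL 0) b
      obtain ⟨ψ, rfl⟩ := t₀.2 b'
      exact ⟨_, thetaDual_comp R S ω ι ψ⟩
  · rintro ⟨hM, hθ⟩
    have hL : ∀ j, ExtVanishes S (LinearMap.range F) (CharDual S ω) (j + 1) := fun j => by
      cases j with
      | zero =>
        refine ExtVanishes.one_of_extension i₁ s₁ e₁ (h₀ 0) fun b => ?_
        obtain ⟨φ, rfl⟩ := hθ.2 b
        obtain ⟨ψ, hψ⟩ := hιφ φ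
        refine ⟨thetaDual R S ω E₀ ψ, ?_⟩
        rw [← thetaDual_comp]
        congr 1
        exact DFunLike.ext _ _ hψ
      | succ j => exact ExtVanishes.left_third i₁ s₁ e₁ (hM j) (h₀ (j + 1))
    intro j
    cases j with
    | zero =>
      -- Pulled back to `(E₀)_*`, `l` is the transpose of a character `ψ`. Injectivity of
      -- `thetaDual` at `M` forces `ψ` to vanish on `M`, so `ψ` factors through `d`, and the
      -- resulting character of `E₁` extends `l`.
      refine ExtVanishes.one_of_extension i₂ s₂ e₂ (h₁ 0) fun l => ?_
      obtain ⟨ψ, hψ⟩ := t₀.2 (l ∘ₗ F.rangeRestrict)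
      have hψι : (show CharacterModule M from AddMonoidHom.comp ψ ι.toAddMonoidHom) = 0 := by
        refine hθ.1 ?_
        rw [thetaDual_comp, hψ]
        refine LinearMap.ext fun f => ?_
        exact (congrArg l (e₁.apply_apply_eq_zero f)).trans (map_zero l)
      obtain ⟨χ, hχ⟩ := exists_character_extension d.toAddMonoidHom ψ fun x hx => by
        obtain ⟨m, rfl⟩ := (hιd x).1 hx
        exact DFunLike.congr_fun hψι m
      refine ⟨thetaDual R S ω E₁ χ, LinearMap.ext fun y => ?_⟩
      obtain ⟨x, rfl⟩ := s₁ y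
      have h2 : (show CharacterModule E₀ from AddMonoidHom.comp χ d.toAddMonoidHom) = ψ :=
        DFunLike.ext _ _ hχ
      have h3 := thetaDual_comp R S ω d χ
      rw [h2, hψ] at h3
      exact (LinearMap.congr_fun h3 x).symm
    | succ j => exact ExtVanishes.left_third i₂ s₂ e₂ (hL j) (h₁ (j + 1))

section Envelope

variable {R}

theorem envelope_exact (M : Type u) [AddCommGroup M] [Module R M] :
    Function.Exact (envelope R M).ι (LinearMap.range (envelope R M).ι).mkQ := by
  rw [LinearMap.exact_iff, Submodule.ker_mkQ]

theorem f0_exact (M : Type u) [AddCommGroup M] [Module R M] :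
    Function.Exact (envelope R M).ι (f0 R M) := by
  rw [LinearMap.exact_iff, f0, LinearMap.ker_comp_of_ker_eq_bot _
    (LinearMap.ker_eq_bot.2 (envelope R (Cosyzygy R M)).ι_injective), Submodule.ker_mkQ]

end Envelope

theorem cotorsionfreeClass_iff (M : ModuleCat.{u} R) : cotorsionfreeClass R S ω M ↔
    ∀ j, ExtVanishes S (Cotranspose R S ω M) (CharDual S ω) (j + 1) := by
  constructor
  · exact fun h j => (isZero_tor_iff R S ω j).1 (h (j + 1) (j + 1) (by lia) le_rfl)
  · intro h n i hi _
    obtain ⟨j, rfl⟩ := Nat.exists_eq_add_of_le' hi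
    exact (isZero_tor_iff R S ω j).2 (h j)

variable {R S ω}

theorem rightPerp.extVanishes {M : ModuleCat.{u} R} (h : rightPerp R ω M) (j : ℕ) :
    ExtVanishes R ω M (j + 1) := h (j + 1) (by lia)

theorem rightPerp_of_extVanishes {M : ModuleCat.{u} R} (h : ∀ j, ExtVanishes R ω M (j + 1)) :
    rightPerp R ω M := fun i hi => by
  obtain ⟨j, rfl⟩ := Nat.exists_eq_add_of_le' hi
  exact h j

theorem rightPerp_cosyzygy {M : ModuleCat.{u} R} (h : rightPerp R ω M) :
    rightPerp R ω (ModuleCat.of R (Cosyzygy R M)) := by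
  have := (envelope R M).injective
  exact rightPerp_of_extVanishes fun j => ExtVanishes.right_third (envelope R M).ι_injective
    (Submodule.mkQ_surjective _) (envelope_exact M) (ExtVanishes.of_injective j)
    (h.extVanishes (j + 1))

theorem HomStar.map_mkQ_surjective {M : ModuleCat.{u} R} (h : rightPerp R ω M) :
    Function.Surjective (HomStar.map R S ω (LinearMap.range (envelope R M).ι).mkQ) :=
  HomStar.map_surjective R S ω (envelope R M).ι_injective (Submodule.mkQ_surjective _)
    (envelope_exact M) (h.extVanishes 0)

/-- On `_Rω^⊥` the cotranspose of `M` is `Hom_R(ω, -)` of its second cosyzygy. -/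
theorem nonempty_cotranspose_equiv {M : ModuleCat.{u} R} (h : rightPerp R ω M) :
    Nonempty (HomStar R ω (Cosyzygy R (Cosyzygy R M)) ≃ₗ[S] Cotranspose R S ω M) := by
  let p := (LinearMap.range (envelope R M).ι).mkQ
  let ι := (envelope R (Cosyzygy R M)).ι
  let q := (LinearMap.range ι).mkQ
  -- Since `Ext¹_R(ω, M) = 0`, `p_*` is onto, so `(f⁰)_* = ι_* ∘ p_*` has the same image as `ι_*`,
  -- namely `ker q_*`.
  have hrange : LinearMap.range (HomStar.map R S ω (f0 R M)) =
      LinearMap.ker (HomStar.map R S ω q) := by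
    rw [LinearMap.exact_iff.1 (HomStar.map_exact R S ω (envelope R (Cosyzygy R M)).ι_injective
      (envelope_exact (Cosyzygy R M)))]
    change LinearMap.range (HomStar.map R S ω ι ∘ₗ HomStar.map R S ω p) = _
    exact LinearMap.range_comp_of_range_eq_top _
      (LinearMap.range_eq_top.2 (HomStar.map_mkQ_surjective h))
  exact ⟨((Submodule.quotEquivOfEq _ _ hrange).trans (LinearMap.quotKerEquivOfSurjective _
    (HomStar.map_mkQ_surjective (rightPerp_cosyzygy h)))).symm⟩

/-! ### Comparison of the three classes. -/

namespace IsSemidualizing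

theorem thetaDual_bijective (hω : IsSemidualizing R S ω) (I : Type u) [AddCommGroup I]
    [Module R I] [Module.Injective R I] : Function.Bijective (thetaDual R S ω I) :=
  have := SMulCommClass.symm R Sᵐᵒᵖ ω
  thetaDual_bijective_of_injective R S ω I (hω.a2.isFP 1) hω.b1

theorem acyclic_homStar_injective (hω : IsSemidualizing R S ω) (I : Type u) [AddCommGroup I]
    [Module R I] [Module.Injective R I] (j : ℕ) :
    ExtVanishes S (HomStar R ω I) (CharDual S ω) (j + 1) :=
  have := SMulCommClass.symm R Sᵐᵒᵖ ω
  extVanishes_homStar_of_injective R S ω I j (hω.a2.isFP _) fun j => hω.c2 (j + 1) (by lia)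

theorem cotorsionfreeClass_iff_acyclic (hω : IsSemidualizing R S ω) (M : ModuleCat.{u} R) :
    cotorsionfreeClass R S ω M ↔
      (∀ j, ExtVanishes S (HomStar R ω M) (CharDual S ω) (j + 1)) ∧
        Function.Bijective (theta R S ω M) := by
  have := (envelope R M).injective
  have := (envelope R (Cosyzygy R M)).injective
  rw [cotorsionfreeClass_iff, ← thetaDual_bijective_iff]
  exact cokernel_acyclic_iff R S ω (envelope R M).ι_injective (f0_exact M)
    (hω.acyclic_homStar_injective _) (hω.acyclic_homStar_injective _)
    (hω.thetaDual_bijective _) (hω.thetaDual_bijective _)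

/-- The Bass class consists of the `∞`-`ω`-cotorsionfree modules in `_Rω^⊥`. -/
theorem bassClass_eq_inf (hω : IsSemidualizing R S ω) :
    bassClass R S ω = rightPerp R ω ⊓ cotorsionfreeClass R S ω := by
  ext M
  change _ ↔ rightPerp R ω M ∧ cotorsionfreeClass R S ω M
  rw [hω.cotorsionfreeClass_iff_acyclic M, bassClass]
  refine and_congr_right fun _ => and_congr_left fun _ => ⟨fun h j => ?_, fun h i hi => ?_⟩
  · exact (isZero_tor_iff R S ω j).1 (h (j + 1) (by lia))
  · obtain ⟨j, rfl⟩ := Nat.exists_eq_add_of_le' hi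
    exact (isZero_tor_iff R S ω j).2 (h j)

/-- Such an `M` is isomorphic to `ω ⊗_S M_*` through `θ_M`, with `M_*` acyclic, so
`extVanishes_tensor` applies. -/
theorem cotorsionfreeClass_le_rightPerp (hω : IsSemidualizing R S ω) (n : ℕ)
    (hn : HasProjectiveDimensionLT (ModuleCat.of R ω) n) :
    cotorsionfreeClass R S ω ≤ rightPerp R ω := fun M hM => by
  obtain ⟨h, hθ⟩ := (hω.cotorsionfreeClass_iff_acyclic M).1 hM
  exact rightPerp_of_extVanishes fun j =>
    (extVanishes_tensor R S ω hω.a1.isFP (fun j => hω.c1 (j + 1) (by lia)) n hn h j).congr_right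
      (LinearEquiv.ofBijective (theta R S ω M) hθ)

theorem acyclic_homStar_of_rightPerp (hω : IsSemidualizing R S ω) (n : ℕ)
    (hn : HasProjectiveDimensionLT (ModuleCat.of Sᵐᵒᵖ ω) (n + 1)) (M : ModuleCat.{u} R)
    (hM : rightPerp R ω M) (i : ℕ) : ExtVanishes S (HomStar R ω M) (CharDual S ω) (i + 1) := by
  -- Here the shift runs along cosyzygies: these stay in `_Rω^⊥`, each `I⁰(M)_*` is acyclic, and
  -- from degree `n + 1` on Ext into `ω⁺` vanishes outright.
  have key : ∀ (m : ℕ) (M : ModuleCat.{u} R), rightPerp R ω M → ∀ i, n ≤ i + m →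
      ExtVanishes S (HomStar R ω M) (CharDual S ω) (i + 1) := by
    intro m
    induction m with
    | zero => exact fun M _ i hi => extVanishes_charDual S n hn (i + 1) (by lia)
    | succ m ih =>
      intro M hM i hi
      have := (envelope R M).injective
      exact ExtVanishes.left_first (HomStar.map_injective R S ω (envelope R M).ι_injective)
        (HomStar.map_mkQ_surjective hM)
        (HomStar.map_exact R S ω (envelope R M).ι_injective (envelope_exact M))
        (hω.acyclic_homStar_injective _ i) (ih _ (rightPerp_cosyzygy hM) (i + 1) (by lia))
  exact key n M hM i (by lia)

/-- The cotranspose is `Hom_R(ω, -)` of the second cosyzygy, itself in `_Rω^⊥`, so acyclicity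
follows without examining `θ_M`. -/
theorem rightPerp_le_cotorsionfreeClass (hω : IsSemidualizing R S ω) (n : ℕ)
    (hn : HasProjectiveDimensionLT (ModuleCat.of Sᵐᵒᵖ ω) (n + 1)) :
    rightPerp R ω ≤ cotorsionfreeClass R S ω := fun M hM => by
  rw [cotorsionfreeClass_iff]
  exact fun j => (hω.acyclic_homStar_of_rightPerp n hn _
    (rightPerp_cosyzygy (rightPerp_cosyzygy hM)) j).congr_left
      (nonempty_cotranspose_equiv hM).some

end IsSemidualizing

end Cotorsionfree

end Semidualizing

theorem proposition3p1 {R S : Type u} [Ring R] [Ring S] {ω : Type u} [AddCommGroup ω]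
    [Module R ω] [Module Sᵐᵒᵖ ω] [SMulCommClass R Sᵐᵒᵖ ω]
    (hω : Semidualizing.IsSemidualizing R S ω) :
    (projectiveDimension (ModuleCat.of R ω) < ⊤ →
      Semidualizing.cotorsionfreeClass R S ω ≤ Semidualizing.rightPerp R ω ∧
      Semidualizing.bassClass R S ω = Semidualizing.cotorsionfreeClass R S ω) ∧
    (projectiveDimension (ModuleCat.of Sᵐᵒᵖ ω) < ⊤ →
      Semidualizing.rightPerp R ω ≤ Semidualizing.cotorsionfreeClass R S ω ∧
      Semidualizing.bassClass R S ω = Semidualizing.rightPerp R ω) := by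
  rw [hω.bassClass_eq_inf]
  refine ⟨fun h => ?_, fun h => ?_⟩
  · obtain ⟨n, hn⟩ := (projectiveDimension_ne_top_iff _).1 h.ne
    -- `hn` says that the projective dimension is at most `n`. This lemma takes the strict bound `n
    -- + 1`; its counterpart in the second case takes `n` itself.
    have hle := hω.cotorsionfreeClass_le_rightPerp (n + 1) hn
    exact ⟨hle, inf_eq_right.2 hle⟩
  · obtain ⟨n, hn⟩ := (projectiveDimension_ne_top_iff _).1 h.ne
    have hle := hω.rightPerp_le_cotorsionfreeClass n hn
    exact ⟨hle, inf_eq_left.2 hle⟩
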